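/- **Notation.** For $A\in M(d,\mathbb R)$ let $\mathfrak g_A=\mathbb R e_0\ltimes_A\mathbb R^{d}$ be the real Lie algebra in which $\mathbb R^d$ is an abelian ideal and $[e_0,v]=Av$ for $v\in\mathbb R^d$. A *symplectic structure* on a real Lie algebra $\mathfrak g$ is a non-degenerate alternating bilinear form $\omega$ on $\mathfrak g$ with $\omega([x,y],z)+\omega([y,z],x)+\omega([z,x],y)=0$ for all $x,y,z\in\mathfrak g$. Let $\mathcal J_r(b)$ be the $r\times r$ Jordan block with eigenvalue $b$. Let $\bigwedge_m$ be the set consisting of the tuple $(m)$ and of all tuples of integers $(n_1,\dots,n_k;p_1,\dots,p_k;t)$ with $k\ge 1$, $n_1>\dots>n_k\ge 2$, $p_i>0$ for all $i$, $t\ge 0$ and $\sum_i n_ip_i+t=m$. If $A\in M(m,\mathbb R)$ has $b\in\mathbb R$ as its only complex eigenvalue, then $\Lambda(A)\in\bigwedge_m$ is the tuple $(m)$ if $A=bI_m$, and otherwise the tuple $(n_1,\dots,n_k;p_1,\dots,p_k;t)$ such that $A$ is conjugate to $\mathcal J_{n_1}(b)^{\oplus p_1}\oplus\dots\oplus\mathcal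 J_{n_k}(b)^{\oplus p_k}\oplus bI_t$. Let $\bigwedge^s_{m}\subseteq\bigwedge_m$ consist of $(m)$ and of those tuples $(n_1,\dots,n_k;p_1,\dots,p_k;t)$ for which either $t$ is odd and $p_i$ is even for all odd $n_i$, or $t$ is even and there is a unique $\ell$ such that $n_\ell$ and $p_\ell$ are both odd. **Theorem.** Let $n\ge 2$ and $M\in M(2n-1,\mathbb R)$. **(I)** If $0$ is the only complex eigenvalue of $M$, then $\mathfrak g_M$ admits a symplectic structure if and only if $\Lambda(M)\in\bigwedge^s_{2n-1}$. **(II)** Suppose that $M$ is conjugate to $M(c)\oplus M(-c)$, where $c\in\mathbb R$, $c\neq0$, $M(c)\in M(n,\mathbb R)$ has $c$ as its only complex eigenvalue, and $M(-c)\in M(n-1,\mathbb R)$ has $-c$ as its only complex eigenvalue. * If $\Lambda(M(-c))=(n-1)$, then $\mathfrak g_M$ admits a symplectic structure if and only if $$\Lambda(M(c))=\begin{cases}(n)&\text{if } M \text{ is diagonalizable},\\ (2;1;n-2)&\text{if } M\text{ is not diagonalizable.}\end{cases}$$ * If $\Lambda(M(-c))=(n_1,\dots,n_k;p_1,\dots,p_k;t)$,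 then $\mathfrak g_M$ admits a symplectic structure if and only if one of the following holds: (i) $\Lambda(M(c))=(n_1,\dots,n_k;p_1,\dots,p_k;t+1)$; (ii) there exists a unique $d\in\{1,\dots,k\}$ such that $\Lambda(M(c))$ is $$\begin{cases}(n_1,\dots,n_{d-1},n_d,\dots,n_k;\,p_1,\dots,p_{d-1}+1,p_d-1,\dots,p_k;\,t)&\text{if } d\ge 2\text{ and } n_{d-1}=n_d+1,\\ (n_1,\dots,n_{d-1},n_d+1,n_d,\dots,n_k;\,p_1,\dots,p_{d-1},1,p_d-1,\dots,p_k;\,t)&\text{if } d=1\text{ or } n_{d-1}>n_d+1,\end{cases}$$ where the entries $n_d$ and $p_d-1$ are left out when $p_d=1$; (iii) $t\ge1$ and $$\Lambda(M(c))=\begin{cases}(n_1,\dots,n_k,2;\,p_1,\dots,p_k,1;\,t-1)&\text{if } n_k>2,\\ (n_1,\dots,n_k;\,p_1,\dots,p_k+1;\,t-1)&\text{if } n_k=2.\end{cases}$$ -/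

import Mathlib

/-! ### Almost abelian Lie algebras and symplectic structures -/

section AlmostAbelian

/- An associative ring is regarded as a Lie ring through the commutator bracket. The rings `ℝ` and
`ι → ℝ` are commutative, so this makes them the abelian Lie algebras `ℝ` and `ℝ^ι`. -/
attribute [local instance] LieRing.ofAssociativeRing LieAlgebra.ofAssociativeAlgebra

/-- The derivation `v ↦ M v` of the abelian Lie algebra `ℝ^ι`. -/
def mulVecDerivation {ι : Type} [Fintype ι] (M : Matrix ι ι ℝ) :
    LieDerivation ℝ (ι → ℝ) (ι → ℝ) where
  toLinearMap := M.mulVecLin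
  leibniz' a b := by
    simp [LieRing.of_associative_ring_bracket, mul_comm]

/-- The action `s ↦ (v ↦ s M v)` of the abelian Lie algebra `ℝ` on the abelian Lie algebra
`ℝ^ι`. -/
def almostAbelianAction {ι : Type} [Fintype ι] (M : Matrix ι ι ℝ) :
    ℝ →ₗ⁅ℝ⁆ LieDerivation ℝ (ι → ℝ) (ι → ℝ) where
  toFun s := s • mulVecDerivation M
  map_add' s t := add_smul s t _
  map_smul' s t := by simp [mul_smul]
  map_lie' := by
    intro s t
    ext v i
    simp [LieRing.of_associative_ring_bracket, mul_comm]

/-- The almost abelian Lie algebra `𝔤_M = ℝ e₀ ⋉_M ℝ^ι`, with bracket determined by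
`⁅e₀, v⁆ = M v` for `v` in the abelian ideal `ℝ^ι`. -/
abbrev AlmostAbelian {ι : Type} [Fintype ι] (M : Matrix ι ι ℝ) : Type :=
  LieAlgebra.SemiDirectSum (ι → ℝ) ℝ (almostAbelianAction M)

/-- The bracket of `𝔤_M`: `⁅v + s e₀, w + t e₀⁆ = s M w - t M v`. -/
theorem AlmostAbelian.lie_def {ι : Type} [Fintype ι] (M : Matrix ι ι ℝ)
    (x y : AlmostAbelian M) :
    ⁅x, y⁆ = ⟨x.right • M.mulVec y.left - y.right • M.mulVec x.left, 0⟩ := by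
  have h : ∀ v w : ι → ℝ, ⁅v, w⁆ = 0 := fun v w => by
    simp [LieRing.of_associative_ring_bracket, mul_comm]
  have h' : ∀ s t : ℝ, ⁅s, t⁆ = 0 := fun s t => by
    simp [LieRing.of_associative_ring_bracket, mul_comm]
  rw [LieAlgebra.SemiDirectSum.lie_eq_mk, h, h', zero_add]
  rfl

end AlmostAbelian

/-- A symplectic structure on a real Lie algebra: a non-degenerate closed 2-form. -/
structure IsSymplecticStructure {𝔤 : Type*} [LieRing 𝔤] [LieAlgebra ℝ 𝔤]
    (ω : LinearMap.BilinForm ℝ 𝔤) : Prop where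
  alt : ω.IsAlt
  nondegenerate : ω.Nondegenerate
  closed : ∀ x y z : 𝔤, -ω ⁅x, y⁆ z - ω ⁅y, z⁆ x - ω ⁅z, x⁆ y = 0

/-- The real Lie algebra `𝔤` admits a symplectic structure. -/
def AdmitsSymplectic (𝔤 : Type*) [LieRing 𝔤] [LieAlgebra ℝ 𝔤] : Prop :=
  ∃ ω : LinearMap.BilinForm ℝ 𝔤, IsSymplecticStructure ω

/-! ### Similarity, spectrum, diagonalizability -/

/-- The real square matrices `A` and `B` (with rows and columns indexed by possibly different finite
types) are conjugate: `A = P B P⁻¹` for an invertible `P`, whose inverse is `Q`. -/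
def AreConjugate {ι κ : Type} [Fintype ι] [DecidableEq ι] [Fintype κ] [DecidableEq κ]
    (A : Matrix ι ι ℝ) (B : Matrix κ κ ℝ) : Prop :=
  ∃ (P : Matrix ι κ ℝ) (Q : Matrix κ ι ℝ), P * Q = 1 ∧ Q * P = 1 ∧ A = P * B * Q

/-- `a` is the only complex eigenvalue of the real matrix `A`. -/
def HasSingleEigenvalue {ι : Type} [Fintype ι] [DecidableEq ι]
    (A : Matrix ι ι ℝ) (a : ℝ) : Prop :=
  spectrum ℂ (A.map (fun x : ℝ => (x : ℂ))) = {(a : ℂ)}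

/-- `A` is diagonalizable (over `ℝ`). -/
def Diagonalizable {ι : Type} [Fintype ι] [DecidableEq ι] (A : Matrix ι ι ℝ) : Prop :=
  ∃ v : ι → ℝ, AreConjugate A (Matrix.diagonal v)

/-! ### Jordan types -/

/-- A tuple recording a Jordan type: either `(m)`, or `(n₁, …, n_k; p₁, …, p_k; t)`. The latter is
given by the list `[(n₁, p₁), …, (n_k, p_k)]` of block sizes with their multiplicities, and by the
number `t` of `1 × 1` blocks. -/
inductive JordanTuple : Type
  | scalar (m : ℕ) : JordanTuple
  | blocks (l : List (ℕ × ℕ)) (t : ℕ) : JordanTuple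

/-- The set of admissible tuples of size `m`: the tuple `(m)`, and the tuples
`(n₁, …, n_k; p₁, …, p_k; t)` with `k ≥ 1`, `n₁ > ⋯ > n_k ≥ 2`, all `p_i > 0`, `t ≥ 0` and
`∑ n_i p_i + t = m`. -/
def jordanTuples (m : ℕ) : Set JordanTuple :=
  {τ | match τ with
    | .scalar m' => m' = m
    | .blocks l t =>
      l ≠ [] ∧ l.Pairwise (fun x y => y.1 < x.1) ∧ (∀ x ∈ l, 2 ≤ x.1 ∧ 0 < x.2) ∧
        (l.map (fun x => x.1 * x.2)).sum + t = m}

/-- The `n × n` Jordan block with eigenvalue `b`, with ones below the diagonal. -/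
def jordanBlock (n : ℕ) (b : ℝ) : Matrix (Fin n) (Fin n) ℝ :=
  Matrix.of fun i j => if i = j then b else if i.val = j.val + 1 then 1 else 0

/-- The matrix `J_{n₁}(b)^{⊕ p₁} ⊕ ⋯ ⊕ J_{n_k}(b)^{⊕ p_k}` for the list
`[(n₁, p₁), …, (n_k, p_k)]`. Its diagonal blocks are indexed by the pairs `(i, j)` with `i < k`
and `j < p_i`. -/
def jordanBlocks (b : ℝ) (l : List (ℕ × ℕ)) :
    Matrix ((x : (i : Fin l.length) × Fin (l.get i).2) × Fin (l.get x.1).1)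
      ((x : (i : Fin l.length) × Fin (l.get i).2) × Fin (l.get x.1).1) ℝ :=
  Matrix.blockDiagonal' fun x => jordanBlock (l.get x.1).1 b

/-- `A` is conjugate to the Jordan matrix with eigenvalue `b` described by the tuple: to `b I_m` for
`(m)`, and to `J_{n₁}(b)^{⊕ p₁} ⊕ ⋯ ⊕ J_{n_k}(b)^{⊕ p_k} ⊕ b I_t` for
`(n₁, …, n_k; p₁, …, p_k; t)`. -/
def ConjugateToJordan {ι : Type} [Fintype ι] [DecidableEq ι] (A : Matrix ι ι ℝ) (b : ℝ) :
    JordanTuple → Prop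
  | .scalar m => AreConjugate A (b • (1 : Matrix (Fin m) (Fin m) ℝ))
  | .blocks l t =>
      AreConjugate A
        (Matrix.fromBlocks (jordanBlocks b l) 0 0 (b • (1 : Matrix (Fin t) (Fin t) ℝ)))

/-- `HasJordanTuple A b τ` says `Λ(A) = τ`, for an `m × m` matrix `A` whose only eigenvalue is `b`:
the tuple `τ` is the admissible tuple of size `m` whose Jordan matrix is conjugate to `A`. -/
def HasJordanTuple {m : ℕ} (A : Matrix (Fin m) (Fin m) ℝ) (b : ℝ) (τ : JordanTuple) : Prop :=
  τ ∈ jordanTuples m ∧ ConjugateToJordan A b τ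

/-- The subset `⋀ˢ_m` of the admissible tuples of size `m`: the tuple `(m)`, and the tuples
`(n₁, …, n_k; p₁, …, p_k; t)` such that either `t` is odd and `p_i` is even for all odd `n_i`, or
`t` is even and there is a unique `ℓ` with `n_ℓ` and `p_ℓ` both odd. -/
def symplecticTuples (m : ℕ) : Set JordanTuple :=
  {τ | τ ∈ jordanTuples m ∧
    match τ with
    | .scalar _ => True
    | .blocks l t =>
        (Odd t ∧ ∀ i : Fin l.length, Odd (l.get i).1 → Even (l.get i).2) ∨
        (Even t ∧ ∃! i : Fin l.length, Odd (l.get i).1 ∧ Odd (l.get i).2)}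

/-- Drop the block sizes of multiplicity zero from a list of block sizes with multiplicities. -/
def dropZero (l : List (ℕ × ℕ)) : List (ℕ × ℕ) :=
  l.filter fun x => x.2 ≠ 0

/-- With `l = [(n₁, p₁), …, (n_k, p_k)]`, the tuple `τ` arises from `(n₁, …, n_k; p₁, …, p_k; t)` by
enlarging one block of size `n_d` to size `n_d + 1` (the index `d` is zero-based in the code):
* if `n_{d-1} = n_d + 1`, then
  `τ = (n₁, …, n_{d-1}, n_d, …, n_k; p₁, …, p_{d-1} + 1, p_d - 1, …, p_k; t)`;
* if `n_{d-1} > n_d + 1`, or if `d` is the first index, then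
  `τ = (n₁, …, n_{d-1}, n_d + 1, n_d, …, n_k; p₁, …, p_{d-1}, 1, p_d - 1, …, p_k; t)`;
where the entries `n_d` and `p_d - 1` are left out if `p_d - 1 = 0`. -/
def IsEnlargementAt (l : List (ℕ × ℕ)) (t : ℕ) (d : Fin l.length) (τ : JordanTuple) : Prop :=
  (∃ e : Fin l.length, e.val + 1 = d.val ∧ (l.get e).1 = (l.get d).1 + 1 ∧
    τ = .blocks
      (dropZero (l.take e.val ++
        ((l.get e).1, (l.get e).2 + 1) :: ((l.get d).1, (l.get d).2 - 1) :: l.drop (d.val + 1)))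
      t) ∨
  ((∀ e : Fin l.length, e.val + 1 = d.val → (l.get d).1 + 1 < (l.get e).1) ∧
    τ = .blocks
      (dropZero (l.take d.val ++
        ((l.get d).1 + 1, 1) :: ((l.get d).1, (l.get d).2 - 1) :: l.drop (d.val + 1)))
      t)

/-- With `l = [(n₁, p₁), …, (n_k, p_k)]`, `k ≥ 1`, the tuple `τ` arises from
`(n₁, …, n_k; p₁, …, p_k; t)`, where `t ≥ 1`, by replacing one `1 × 1` block by a block of size `2`:
`τ = (n₁, …, n_k, 2; p₁, …, p_k, 1; t - 1)` if `n_k > 2`, and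
`τ = (n₁, …, n_k; p₁, …, p_k + 1; t - 1)` if `n_k = 2`. -/
def IsOneToTwo (l : List (ℕ × ℕ)) (t : ℕ) (τ : JordanTuple) : Prop :=
  1 ≤ t ∧ ∃ (l' : List (ℕ × ℕ)) (a p : ℕ), l = l' ++ [(a, p)] ∧
    ((2 < a ∧ τ = .blocks (l ++ [(2, 1)]) (t - 1)) ∨
      (a = 2 ∧ τ = .blocks (l' ++ [(a, p + 1)]) (t - 1)))

/-! ### Conjugacy of real matrices -/

namespace AreConjugate

variable {ι κ τ : Type} [Fintype ι] [DecidableEq ι] [Fintype κ] [DecidableEq κ]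
  [Fintype τ] [DecidableEq τ]

/-! A symplectic form on `𝔤_M` amounts to a skew matrix `η` on the ideal with `η M + Mᵀ η = 0` and a
covector `α` (the pairing with `e₀`), where non-degeneracy makes `α` injective on `ker η`. In both
cases of the theorem a certain kernel is therefore a line `K`. For a nilpotent `N`, the spaces
`range (N ^ k) ⊓ K` have dimension 1 up to some `h` and 0 afterwards. Since the number of Jordan
blocks of size `k + 1` is the second difference of the ranks of `N ^ k`, this one integer `h`
governs the Jordan type.

Nilpotent case (`IsSymplecticPair.odd_card`): `η M ^ (2j)` is again skew, so its rank `rank (M ^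
(2j)) - [2j ≤ h]` is even. Modulo 2 the number of blocks of size `2j + 1` is then `[2j ≤ h] + [2j +
2 ≤ h]`, so exactly one odd size has odd multiplicity.

Opposite eigenvalues (`IsSymplecticPair.exists_rank_eq`): a Sylvester equation kills the diagonal
blocks of `η`, and the remaining block is a surjection with one-dimensional kernel intertwining the
nilpotent part `N` at `c` with `-N'ᵀ`, where `N'` is that at `-c`. Hence `rank (N ^ k) = rank (N' ^
k) + [k ≤ h]`: the type at `c` is the type at `-c` with one block of size `h` enlarged by one, `h =
0` meaning a new block of size 1.

Both converses come from one explicit form (`isSymplecticPair_jordanMatrix`): shorten one block by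
one, pair the chains of basis vectors antidiagonally with alternating signs, and let `α` detect the
vector that was cut off. The rest translates block counts into tuples. -/

theorem refl (A : Matrix ι ι ℝ) : AreConjugate A A := ⟨1, 1, by simp, by simp, by simp⟩

theorem symm {A : Matrix ι ι ℝ} {B : Matrix κ κ ℝ} (h : AreConjugate A B) : AreConjugate B A := by
  obtain ⟨P, Q, h1, h2, rfl⟩ := h
  refine ⟨Q, P, h2, h1, ?_⟩
  calc B = (Q * P) * B * (Q * P) := by simp [h2]
    _ = Q * (P * B * Q) * P := by simp only [Matrix.mul_assoc]

theorem trans {A : Matrix ι ι ℝ} {B : Matrix κ κ ℝ} {C : Matrix τ τ ℝ} (h : AreConjugate A B)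
    (h' : AreConjugate B C) : AreConjugate A C := by
  obtain ⟨P, Q, h1, h2, rfl⟩ := h
  obtain ⟨P', Q', h1', h2', rfl⟩ := h'
  refine ⟨P * P', Q' * Q, ?_, ?_, ?_⟩
  · rw [Matrix.mul_assoc, ← Matrix.mul_assoc P', h1', Matrix.one_mul, h1]
  · rw [Matrix.mul_assoc, ← Matrix.mul_assoc Q, h2, Matrix.one_mul, h2']
  · simp only [Matrix.mul_assoc]

theorem submatrix_equiv (B : Matrix κ κ ℝ) (e : ι ≃ κ) : AreConjugate (B.submatrix e e) B := by
  refine ⟨(1 : Matrix κ κ ℝ).submatrix e id, (1 : Matrix κ κ ℝ).submatrix id e, ?_, ?_, ?_⟩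
  · rw [← Matrix.submatrix_mul _ _ _ id _ Function.bijective_id]; simp
  · rw [← Matrix.submatrix_mul _ _ _ e _ e.bijective]; simp
  · ext i j
    simp [Matrix.mul_apply, Matrix.one_apply]

theorem card_eq {A : Matrix ι ι ℝ} {B : Matrix κ κ ℝ} (h : AreConjugate A B) :
    Fintype.card ι = Fintype.card κ := by
  obtain ⟨P, Q, h1, h2, -⟩ := h
  exact Matrix.square_of_invertible P Q h1 h2

theorem sub_smul_one {A : Matrix ι ι ℝ} {B : Matrix κ κ ℝ} (h : AreConjugate A B) (b : ℝ) :
    AreConjugate (A - b • 1) (B - b • 1) := by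
  obtain ⟨P, Q, h1, h2, rfl⟩ := h
  exact ⟨P, Q, h1, h2, by simp [Matrix.mul_sub, Matrix.sub_mul, h1]⟩

theorem pow {A : Matrix ι ι ℝ} {B : Matrix κ κ ℝ} (h : AreConjugate A B) (k : ℕ) :
    AreConjugate (A ^ k) (B ^ k) := by
  obtain ⟨P, Q, h1, h2, rfl⟩ := h
  refine ⟨P, Q, h1, h2, ?_⟩
  induction k with
  | zero => simp [h1]
  | succ k ih =>
    rw [pow_succ, ih, pow_succ]
    calc P * B ^ k * Q * (P * B * Q) = P * B ^ k * (Q * P) * B * Q := by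
          simp only [Matrix.mul_assoc]
      _ = _ := by rw [h2]; simp only [Matrix.mul_assoc, Matrix.mul_one]

theorem rank_eq {A : Matrix ι ι ℝ} {B : Matrix κ κ ℝ} (h : AreConjugate A B) :
    A.rank = B.rank := by
  have key : ∀ {ι κ : Type} [Fintype ι] [DecidableEq ι] [Fintype κ] [DecidableEq κ]
      {A : Matrix ι ι ℝ} {B : Matrix κ κ ℝ}, AreConjugate A B → A.rank ≤ B.rank := by
    intro ι κ _ _ _ _ A B h
    obtain ⟨P, Q, h1, h2, rfl⟩ := h
    exact (Matrix.rank_mul_le_left _ _).trans (Matrix.rank_mul_le_right _ _)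
  exact le_antisymm (key h) (key h.symm)

theorem eq_zero {A : Matrix ι ι ℝ} {B : Matrix κ κ ℝ} (h : AreConjugate A B) (hB : B = 0) :
    A = 0 := by
  obtain ⟨P, Q, -, -, rfl⟩ := h
  simp [hB]

theorem eq_smul_one {A : Matrix ι ι ℝ} {b : ℝ}
    (h : AreConjugate A (b • (1 : Matrix κ κ ℝ))) : A = b • 1 := by
  obtain ⟨P, Q, h1, -, rfl⟩ := h
  simp [h1]

theorem fromBlocks {ι' κ' : Type} [Fintype ι'] [DecidableEq ι'] [Fintype κ'] [DecidableEq κ']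
    {A : Matrix ι ι ℝ} {B : Matrix κ κ ℝ} {A' : Matrix ι' ι' ℝ} {B' : Matrix κ' κ' ℝ}
    (h : AreConjugate A A') (h' : AreConjugate B B') :
    AreConjugate (Matrix.fromBlocks A 0 0 B) (Matrix.fromBlocks A' 0 0 B') := by
  obtain ⟨P, Q, h1, h2, rfl⟩ := h
  obtain ⟨P', Q', h1', h2', rfl⟩ := h'
  refine ⟨Matrix.fromBlocks P 0 0 P', Matrix.fromBlocks Q 0 0 Q', ?_, ?_, ?_⟩ <;>
    simp [Matrix.fromBlocks_multiply, *]

theorem of_basis {A : Matrix ι ι ℝ} {B : Matrix κ κ ℝ} (b : Module.Basis κ ℝ (ι → ℝ))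
    (h : ∀ j, A.mulVec (b j) = ∑ i, B i j • b i) : AreConjugate A B := by
  have hPQ := (Pi.basisFun ℝ ι).toMatrix_mul_toMatrix_flip b
  have hQP := b.toMatrix_mul_toMatrix_flip (Pi.basisFun ℝ ι)
  refine ⟨(Pi.basisFun ℝ ι).toMatrix b, b.toMatrix (Pi.basisFun ℝ ι), hPQ, hQP, ?_⟩
  have key : A * (Pi.basisFun ℝ ι).toMatrix b = (Pi.basisFun ℝ ι).toMatrix b * B := by
    ext i j
    have := congrFun (h j) i
    simp only [Matrix.mulVec, dotProduct, Finset.sum_apply, Pi.smul_apply, smul_eq_mul] at this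
    simp only [Matrix.mul_apply, Module.Basis.toMatrix_apply, Pi.basisFun_repr, this, mul_comm]
  rw [← key, Matrix.mul_assoc, hPQ, Matrix.mul_one]

end AreConjugate

/-- Over `ℂ` the characteristic polynomial must be a power of `X - b`, so Cayley–Hamilton gives
nilpotency there; it descends because the entrywise embedding of real matrices is injective. -/
theorem HasSingleEigenvalue.isNilpotent_sub {ι : Type} [Fintype ι] [DecidableEq ι]
    {A : Matrix ι ι ℝ} {b : ℝ} (h : HasSingleEigenvalue A b) : IsNilpotent (A - b • 1) := by
  set C : Matrix ι ι ℂ := A.map (fun x : ℝ => (x : ℂ)) with hC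
  have hroots : ∀ z ∈ C.charpoly.roots, z = (b : ℂ) := by
    intro z hz
    have : z ∈ spectrum ℂ C :=
      Matrix.mem_spectrum_iff_isRoot_charpoly.2 (Polynomial.isRoot_of_mem_roots hz)
    rw [h] at this
    exact this
  have hsplit := (IsAlgClosed.splits C.charpoly).eq_prod_roots_of_monic C.charpoly_monic
  rw [Multiset.eq_replicate_card.2 hroots] at hsplit
  have hz := C.aeval_self_charpoly
  rw [hsplit] at hz
  simp only [Multiset.map_replicate, Multiset.prod_replicate, map_pow, map_sub,
    Polynomial.aeval_X, Polynomial.aeval_C] at hz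
  refine ⟨C.charpoly.roots.card, ?_⟩
  have hinj : Function.Injective (Complex.ofRealHom.mapMatrix : Matrix ι ι ℝ →+* Matrix ι ι ℂ) :=
    Matrix.map_injective Complex.ofReal_injective
  apply hinj
  rw [map_pow, map_zero, map_sub, ← hz]
  congr 2
  ext i j
  simp [Algebra.algebraMap_eq_smul_one, Matrix.one_apply]
  split_ifs <;> simp

/-! ### Jordan matrices -/

/-- The direct sum of the Jordan blocks of sizes `f x` and eigenvalues `ev x`. -/
def jordanMatrix {κ : Type} [DecidableEq κ] (f : κ → ℕ) (ev : κ → ℝ) :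
    Matrix ((x : κ) × Fin (f x)) ((x : κ) × Fin (f x)) ℝ :=
  Matrix.blockDiagonal' fun x => jordanBlock (f x) (ev x)

section JordanMatrix

variable {κ : Type} [DecidableEq κ]

theorem jordanMatrix_apply (f : κ → ℕ) (ev : κ → ℝ) (a b : (x : κ) × Fin (f x)) :
    jordanMatrix f ev a b = (if a = b then ev a.1 else 0) +
      (if a.1 = b.1 ∧ a.2.val = b.2.val + 1 then 1 else 0) := by
  obtain ⟨x, i⟩ := a
  obtain ⟨y, j⟩ := b
  rw [jordanMatrix, Matrix.blockDiagonal'_apply]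
  by_cases h : x = y
  · subst h
    by_cases hij : i = j
    · subst hij; simp [jordanBlock]
    · simp [jordanBlock, hij]
  · simp [h]

theorem jordanMatrix_sub_smul_one (f : κ → ℕ) (b : ℝ) :
    jordanMatrix f (fun _ => b) - b • 1 = jordanMatrix f (fun _ => 0) := by
  ext a a'
  by_cases h : a = a' <;> simp [jordanMatrix_apply, h]

theorem AreConjugate.jordanMatrix_congr [Fintype κ] {κ' : Type} [DecidableEq κ'] [Fintype κ']
    {f : κ → ℕ} {g : κ' → ℕ} {ev : κ → ℝ} {ev' : κ' → ℝ}
    (e : κ ≃ κ') (hf : ∀ x, f x = g (e x)) (hev : ∀ x, ev x = ev' (e x)) :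
    AreConjugate (jordanMatrix f ev) (jordanMatrix g ev') := by
  obtain rfl : f = g ∘ e := funext hf
  obtain rfl : ev = ev' ∘ e := funext hev
  let E : ((x : κ) × Fin ((g ∘ e) x)) ≃ ((y : κ') × Fin (g y)) :=
    Equiv.sigmaCongrLeft (β := fun y => Fin (g y)) e
  suffices h : jordanMatrix (g ∘ e) (ev' ∘ e) = (jordanMatrix g ev').submatrix E E by
    rw [h]; exact AreConjugate.submatrix_equiv _ E
  ext a b
  have hE : (E a = E b) = (a = b) := propext E.apply_eq_iff_eq
  have h1 : ((E a).1 = (E b).1) = (a.1 = b.1) := propext e.apply_eq_iff_eq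
  rw [Matrix.submatrix_apply, jordanMatrix_apply, jordanMatrix_apply]
  simp only [hE, h1]
  rfl

/-- Blocks of size 0 contribute no indices. Allowing them later lets a new `1 × 1` block count as an
enlarged empty block. -/
theorem AreConjugate.jordanMatrix_subtype [Fintype κ] (f : κ → ℕ) (ev : κ → ℝ) :
    AreConjugate (jordanMatrix (fun x : {x // f x ≠ 0} => f x) (fun x => ev x))
      (jordanMatrix f ev) := by
  let e : ((x : {x // f x ≠ 0}) × Fin (f x)) ≃ ((x : κ) × Fin (f x)) :=
    { toFun := fun a => ⟨a.1, a.2⟩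
      invFun := fun a => ⟨⟨a.1, fun h => (h ▸ a.2 : Fin 0).elim0⟩, a.2⟩
      left_inv := fun a => rfl
      right_inv := fun a => rfl }
  convert AreConjugate.submatrix_equiv (jordanMatrix f ev) e using 1
  ext a b
  rw [Matrix.submatrix_apply, jordanMatrix_apply, jordanMatrix_apply]
  congr 1
  · simp only [e.apply_eq_iff_eq]; rfl
  · simp only [Subtype.ext_iff]; rfl

/-- Jordan matrices with the same number of blocks of each positive size are conjugate. -/
theorem AreConjugate.jordanMatrix_of_card [Fintype κ] {κ' : Type} [DecidableEq κ'] [Fintype κ']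
    {f : κ → ℕ} {g : κ' → ℕ} (b : ℝ)
    (h : ∀ k, Fintype.card {x // f x = k + 1} = Fintype.card {y // g y = k + 1}) :
    AreConjugate (jordanMatrix f fun _ => b) (jordanMatrix g fun _ => b) := by
  have e : ∀ k, Nonempty ({x : {x // f x ≠ 0} // f x = k} ≃ {y : {y // g y ≠ 0} // g y = k}) := by
    intro k
    rcases k with _ | k
    · have := Subtype.isEmpty_of_false (p := fun x : {x // f x ≠ 0} => f x = 0) fun x => x.2
      have := Subtype.isEmpty_of_false (p := fun y : {y // g y ≠ 0} => g y = 0) fun y => y.2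
      exact ⟨Equiv.equivOfIsEmpty _ _⟩
    · have e1 : ∀ {κ : Type} (f : κ → ℕ),
          Nonempty ({x : {x // f x ≠ 0} // f x = k + 1} ≃ {x // f x = k + 1}) := fun f =>
        ⟨Equiv.subtypeSubtypeEquivSubtype (p := fun x => f x ≠ 0) (q := fun x => f x = k + 1)
          (fun h => by rw [h]; simp)⟩
      exact ⟨(e1 f).some.trans ((Fintype.equivOfCardEq (h k)).trans (e1 g).some.symm)⟩
  let E : {x // f x ≠ 0} ≃ {y // g y ≠ 0} :=
    Equiv.ofFiberEquiv (f := fun x : {x // f x ≠ 0} => f x)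
      (g := fun y : {y // g y ≠ 0} => g y) fun k => (e k).some
  have hE : ∀ x : {x // f x ≠ 0}, f x = g (E x) := fun x =>
    (Equiv.ofFiberEquiv_map (f := fun x : {x // f x ≠ 0} => f x)
      (g := fun y : {y // g y ≠ 0} => g y) (fun k => (e k).some) x).symm
  exact (AreConjugate.jordanMatrix_subtype f _).symm.trans
    ((AreConjugate.jordanMatrix_congr E hE fun _ => rfl).trans
      (AreConjugate.jordanMatrix_subtype g fun _ => b))

theorem AreConjugate.jordanMatrix_sum [Fintype κ] {κ' : Type} [DecidableEq κ'] [Fintype κ']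
    (f : κ → ℕ) (g : κ' → ℕ) (ev : κ → ℝ) (ev' : κ' → ℝ) :
    AreConjugate (Matrix.fromBlocks (jordanMatrix f ev) 0 0 (jordanMatrix g ev'))
      (jordanMatrix (Sum.elim f g) (Sum.elim ev ev')) := by
  refine AreConjugate.symm ?_
  convert AreConjugate.submatrix_equiv
    (Matrix.fromBlocks (jordanMatrix f ev) 0 0 (jordanMatrix g ev'))
    (Equiv.sumSigmaDistrib (fun x => Fin (Sum.elim f g x))) using 1
  ext a b
  rcases a with ⟨x | x, i⟩ <;> rcases b with ⟨y | y, j⟩ <;>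
    simp [jordanMatrix_apply, Equiv.sumSigmaDistrib]
  · congr 1
    simp [Sigma.ext_iff]
  · congr 1
    simp [Sigma.ext_iff]

theorem jordanMatrix_pow_apply [Fintype κ] (f : κ → ℕ) (k : ℕ) (a b : (x : κ) × Fin (f x)) :
    (jordanMatrix f (fun _ => 0) ^ k) a b =
      if a.1 = b.1 ∧ a.2.val = b.2.val + k then 1 else 0 := by
  induction k generalizing a with
  | zero =>
    have : a = b ↔ a.1 = b.1 ∧ a.2.val = b.2.val := by
      obtain ⟨x, i⟩ := a
      obtain ⟨y, j⟩ := b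
      constructor
      · rintro h; cases h; simp
      · rintro ⟨h, h'⟩; dsimp at h h'; subst h; simp [Fin.ext h']
    simp [Matrix.one_apply, this]
  | succ k ih =>
    rw [pow_succ', Matrix.mul_apply]
    simp only [ih, jordanMatrix_apply, ite_self, zero_add, mul_ite, mul_one, mul_zero, ← ite_and]
    obtain ⟨x, i⟩ := a
    obtain ⟨y, j⟩ := b
    dsimp only
    split_ifs with h
    · obtain ⟨rfl, h⟩ := h
      have hi := i.2
      rw [Finset.sum_eq_single ⟨x, ⟨j + k, by omega⟩⟩]
      · simp; omega
      · rintro ⟨z, l⟩ - hz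
        rw [if_neg]
        rintro ⟨⟨h1, h2⟩, h3, h4⟩
        dsimp at *
        subst h1
        exact hz (by congr; exact Fin.ext h2)
      · simp
    · refine Finset.sum_eq_zero fun c _ => if_neg ?_
      rintro ⟨⟨h1, h2⟩, h3, h4⟩
      exact h ⟨h3.trans h1, by omega⟩

theorem jordanMatrix_pow_eq_zero [Fintype κ] (f : κ → ℕ) (k : ℕ) (h : ∀ x, f x ≤ k) :
    jordanMatrix f (fun _ => 0) ^ k = 0 := by
  ext a b
  rw [jordanMatrix_pow_apply, if_neg, Matrix.zero_apply]
  have := a.2.2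
  have := h a.1
  omega

/-- The `k`-th power shifts every chain by `k`, so its product with its transpose is a diagonal 0/1
matrix whose ones can be counted. -/
theorem rank_jordanMatrix_pow [Fintype κ] (f : κ → ℕ) (k : ℕ) :
    (jordanMatrix f (fun _ => 0) ^ k).rank = ∑ x, (f x - k) := by
  have key : jordanMatrix f (fun _ => 0) ^ k * (jordanMatrix f (fun _ => 0) ^ k).transpose =
      Matrix.diagonal fun a => if k ≤ a.2.val then 1 else 0 := by
    ext a b
    rw [Matrix.mul_apply]
    simp only [Matrix.transpose_apply, jordanMatrix_pow_apply, mul_ite, mul_one, mul_zero,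
      ← ite_and, Matrix.diagonal_apply]
    obtain ⟨x, i⟩ := a
    obtain ⟨y, j⟩ := b
    dsimp only
    split_ifs with h
    · cases h.1
      have hi := i.2
      rw [Finset.sum_eq_single ⟨x, ⟨i - k, by omega⟩⟩]
      · simp; omega
      · rintro ⟨z, l⟩ - hz
        rw [if_neg]
        rintro ⟨⟨h1, h2⟩, h3, h4⟩
        dsimp at *
        subst h1
        exact hz (by congr; apply Fin.ext; dsimp; omega)
      · simp
    · refine Finset.sum_eq_zero fun c _ => if_neg ?_
      rintro ⟨⟨h1, h2⟩, h3, h4⟩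
      obtain rfl : x = y := by rw [h1, h3]
      exact h ⟨by congr; apply Fin.ext; omega, by omega⟩
  rw [← Matrix.rank_self_mul_transpose, key, Matrix.rank_diagonal]
  have : ∀ a : (x : κ) × Fin (f x), (if k ≤ a.2.val then (1 : ℝ) else 0) ≠ 0 ↔ k ≤ a.2.val := by
    intro a; split_ifs <;> simp [*]
  rw [Fintype.card_congr (Equiv.subtypeEquivRight this), Fintype.card_subtype,
    Finset.card_filter, Fintype.sum_sigma]
  refine Finset.sum_congr rfl fun x _ => ?_
  rw [← Finset.card_filter]
  dsimp only
  have := Fin.card_filter_val_lt (m := k) (n := f x)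
  have h2 := Finset.card_filter_add_card_filter_not (s := (Finset.univ : Finset (Fin (f x))))
    (fun i => i.val < k)
  simp only [not_lt, Finset.card_univ, Fintype.card_fin] at h2
  omega

end JordanMatrix

/-! ### Existence of the Jordan form -/

section JordanForm

open Polynomial

/-- In the basis of powers of `X`, multiplication by `X` is the nilpotent Jordan block with ones
below the diagonal. -/
theorem exists_basis_quotient_X_pow (k : ℕ) :
    ∃ b : Module.Basis (Fin k) ℝ (ℝ[X] ⧸ Submodule.span ℝ[X] {(X : ℝ[X]) ^ k}),
      ∀ j, b j = Submodule.Quotient.mk (X ^ j.val) := by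
  have hd : (X ^ k : ℝ[X]).natDegree = k := natDegree_X_pow k
  let b : Module.Basis (Fin (X ^ k : ℝ[X]).natDegree) ℝ
      (ℝ[X] ⧸ Submodule.span ℝ[X] {(X : ℝ[X]) ^ k}) := (AdjoinRoot.powerBasis' (monic_X_pow k)).basis
  refine ⟨b.reindex (finCongr hd), fun j => ?_⟩
  rw [Module.Basis.reindex_apply]
  have := (AdjoinRoot.powerBasis' (monic_X_pow (R := ℝ) k)).basis_eq_pow
    ((finCongr hd).symm j)
  refine this.trans ?_
  rw [AdjoinRoot.powerBasis'_gen]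
  exact (map_pow (AdjoinRoot.mk _) X _).symm

/-- Every nilpotent real matrix is conjugate to a Jordan matrix. -/
theorem IsNilpotent.exists_areConjugate_jordanMatrix {ι : Type} [Fintype ι] [DecidableEq ι]
    {N : Matrix ι ι ℝ} (hN : IsNilpotent N) :
    ∃ (d : ℕ) (f : Fin d → ℕ), AreConjugate N (jordanMatrix f fun _ => 0) := by
  obtain ⟨m, hm⟩ := hN
  let φ : Module.End ℝ (ι → ℝ) := Matrix.toLin' N
  have hφ : φ ^ m = 0 := by
    rw [← Matrix.toLin'_pow, hm, map_zero]
  -- With `X` acting as `N`, the space is an `X`-power torsion `ℝ[X]`-module, so the structure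
  -- theorem splits it into cyclic pieces `ℝ[X] / (X ^ f i)`.
  have htors : Module.IsTorsion' (Module.AEval' φ) (Submonoid.powers (X : ℝ[X])) := by
    intro x
    obtain ⟨v, rfl⟩ := (Module.AEval'.of φ).surjective x
    refine ⟨⟨X ^ m, m, rfl⟩, ?_⟩
    change (X ^ m : ℝ[X]) • (Module.AEval'.of φ) v = 0
    rw [Module.AEval'.X_pow_smul_of, hφ]
    simp
  obtain ⟨d, f, ⟨e⟩⟩ := Module.torsion_by_prime_power_decomposition irreducible_X htors
  choose b hb using exists_basis_quotient_X_pow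
  let E := e.trans (DirectSum.linearEquivFunOnFintype ℝ[X] (Fin d)
    fun i => ℝ[X] ⧸ Submodule.span ℝ[X] {(X : ℝ[X]) ^ f i})
  let B : Module.Basis ((i : Fin d) × Fin (f i)) ℝ (ι → ℝ) :=
    (Pi.basis fun i => b (f i)).map
      ((E.restrictScalars ℝ).symm.trans (Module.AEval'.of φ).symm)
  -- The chain vectors are indexed by all naturals, vanishing from `f i` on, so that `N` acts by `j
  -- ↦ j + 1` without a case split at the end of a chain.
  let w : Fin d → ℕ → (ι → ℝ) := fun i j => (Module.AEval'.of φ).symm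
    (E.symm (Pi.single i (Submodule.Quotient.mk (X ^ j))))
  have hB : ∀ a, B a = w a.1 a.2 := by
    intro a
    simp only [B, w, Module.Basis.map_apply, Pi.basis_apply, hb]
    rfl
  have hw : ∀ i j, N.mulVec (w i j) = w i (j + 1) := by
    intro i j
    have h1 : Module.AEval'.of φ (φ (w i j)) = X • Module.AEval'.of φ (w i j) :=
      (Module.AEval'.X_smul_of φ _).symm
    have h2 : φ (w i j) = N.mulVec (w i j) := Matrix.toLin'_apply _ _
    rw [← h2, ← (Module.AEval'.of φ).symm_apply_apply (φ (w i j)), h1]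
    simp only [w, LinearEquiv.apply_symm_apply, ← map_smul E.symm, ← Pi.single_smul,
      ← Submodule.Quotient.mk_smul, smul_eq_mul, ← pow_succ']
  have hw0 : ∀ i j, f i ≤ j → w i j = 0 := by
    intro i j hij
    have : (Submodule.Quotient.mk (X ^ j) : ℝ[X] ⧸ Submodule.span ℝ[X] {(X : ℝ[X]) ^ f i}) = 0 := by
      rw [Submodule.Quotient.mk_eq_zero, Submodule.mem_span_singleton]
      exact ⟨X ^ (j - f i), by rw [smul_eq_mul, ← pow_add]; congr 1; omega⟩
    simp only [w, this, Pi.single_zero, map_zero]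
  refine ⟨d, f, AreConjugate.of_basis B ?_⟩
  rintro ⟨i, j⟩
  simp only [hB, hw, jordanMatrix_apply, ite_self, zero_add, ite_smul, one_smul, zero_smul]
  by_cases h : j.val + 1 < f i
  · rw [Finset.sum_eq_single ⟨i, ⟨j + 1, h⟩⟩]
    · simp
    · rintro ⟨i', j'⟩ - hne
      rw [if_neg]
      rintro ⟨h1, h2⟩
      dsimp at h1 h2
      subst h1
      exact hne (by congr; exact Fin.ext h2)
    · simp
  · rw [hw0 _ _ (not_lt.1 h), Finset.sum_eq_zero]
    rintro ⟨i', j'⟩ -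
    rw [if_neg]
    rintro ⟨h1, h2⟩
    dsimp at h1 h2
    subst h1
    exact h (h2 ▸ j'.2)

end JordanForm

/-! ### Symplectic structures on almost abelian Lie algebras through matrices -/

/-- The skew-symmetric matrix `η` and the covector `α` define a symplectic structure on `𝔤_M`: the
restriction to the abelian ideal has matrix `η`, and `α` is the pairing of the ideal with `e₀`. -/
structure IsSymplecticPair {ι : Type} [Fintype ι] (M η : Matrix ι ι ℝ) (α : ι → ℝ) : Prop where
  skew : η.transpose = -η
  compat : η * M + M.transpose * η = 0
  nondeg : ∀ (v : ι → ℝ) (s : ℝ), η.mulVec v + s • α = 0 → α ⬝ᵥ v = 0 → v = 0 ∧ s = 0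

section SymplecticPair

variable {ι : Type} [Fintype ι]

open LieAlgebra

attribute [local instance] LieRing.ofAssociativeRing LieAlgebra.ofAssociativeAlgebra

theorem Matrix.dotProduct_mulVec_skew {η : Matrix ι ι ℝ} (h : η.transpose = -η) (v w : ι → ℝ) :
    v ⬝ᵥ η.mulVec w = -(w ⬝ᵥ η.mulVec v) := by
  rw [Matrix.dotProduct_mulVec, ← Matrix.mulVec_transpose, h, Matrix.neg_mulVec,
    neg_dotProduct, dotProduct_comm]

/-- The bilinear form on `𝔤_M` given by the matrix `η` and the covector `α`. -/
noncomputable def symplecticPairForm (M η : Matrix ι ι ℝ) (α : ι → ℝ) :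
    LinearMap.BilinForm ℝ (AlmostAbelian M) :=
  LinearMap.mk₂ ℝ (fun x y => x.left ⬝ᵥ η.mulVec y.left + y.right * (α ⬝ᵥ x.left) -
      x.right * (α ⬝ᵥ y.left))
    (fun x x' y => by simp only [SemiDirectSum.add_eq_mk, add_dotProduct, dotProduct_add]; ring)
    (fun c x y => by
      simp only [SemiDirectSum.smul_eq_mk, smul_dotProduct, dotProduct_smul, smul_eq_mul]; ring)
    (fun x y y' => by
      simp only [SemiDirectSum.add_eq_mk, Matrix.mulVec_add, dotProduct_add]; ring)
    (fun c x y => by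
      simp only [SemiDirectSum.smul_eq_mk, Matrix.mulVec_smul, dotProduct_smul, smul_eq_mul]; ring)

theorem symplecticPairForm_apply (M η : Matrix ι ι ℝ) (α : ι → ℝ) (x y : AlmostAbelian M) :
    symplecticPairForm M η α x y = x.left ⬝ᵥ η.mulVec y.left + y.right * (α ⬝ᵥ x.left) -
      x.right * (α ⬝ᵥ y.left) := rfl

theorem IsSymplecticPair.isSymplecticStructure {M η : Matrix ι ι ℝ} {α : ι → ℝ}
    (h : IsSymplecticPair M η α) : IsSymplecticStructure (symplecticPairForm M η α) := by
  have hself : ∀ v : ι → ℝ, v ⬝ᵥ η.mulVec v = 0 := fun v => by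
    have := Matrix.dotProduct_mulVec_skew h.skew v v
    linarith
  have halt : (symplecticPairForm M η α).IsAlt := fun x => by
    rw [symplecticPairForm_apply, hself]; ring
  refine ⟨halt, ?_, ?_⟩
  · rw [LinearMap.BilinForm.Nondegenerate, halt.isRefl.nondegenerate_iff_separatingRight]
    intro y hy
    have h1 : η.mulVec y.left + y.right • α = 0 := by
      refine dotProduct_eq_zero_iff.1 fun w => ?_
      have := hy ⟨w, 0⟩
      rw [symplecticPairForm_apply] at this
      rw [add_dotProduct, smul_dotProduct, dotProduct_comm _ w, smul_eq_mul]
      linarith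
    have h2 : α ⬝ᵥ y.left = 0 := by
      have := hy ⟨0, 1⟩
      rw [symplecticPairForm_apply] at this
      simpa using this
    obtain ⟨h3, h4⟩ := h.nondeg _ _ h1 h2
    ext1
    · exact h3
    · exact h4
  -- Compatibility with `M` says that `(v, w) ↦ η(M v, w)` is symmetric; closedness is a combination
  -- of three such symmetries.
  · have key : ∀ v w : ι → ℝ,
        (M.mulVec v) ⬝ᵥ η.mulVec w = (M.mulVec w) ⬝ᵥ η.mulVec v := by
      intro v w
      have h1 := congrArg (fun A : Matrix ι ι ℝ => v ⬝ᵥ A.mulVec w) h.compat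
      simp only [Matrix.add_mulVec, ← Matrix.mulVec_mulVec, dotProduct_add, Matrix.zero_mulVec,
        dotProduct_zero] at h1
      rw [Matrix.dotProduct_mulVec_skew h.skew v, Matrix.dotProduct_mulVec v M.transpose,
        Matrix.vecMul_transpose] at h1
      linarith
    intro x y z
    simp only [AlmostAbelian.lie_def, symplecticPairForm_apply, sub_dotProduct, smul_dotProduct,
      dotProduct_sub, dotProduct_smul, smul_eq_mul]
    rw [key y.left x.left, key z.left x.left, key z.left y.left]
    ring

theorem IsSymplecticStructure.exists_isSymplecticPair [DecidableEq ι] {M : Matrix ι ι ℝ}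
    {ω : LinearMap.BilinForm ℝ (AlmostAbelian M)} (h : IsSymplecticStructure ω) :
    ∃ η α, IsSymplecticPair M η α := by
  let L : (ι → ℝ) →ₗ[ℝ] AlmostAbelian M := 
    (SemiDirectSum.inl (almostAbelianAction M) : (ι → ℝ) →ₗ⁅ℝ⁆ AlmostAbelian M).toLinearMap
  let e : AlmostAbelian M := ⟨0, 1⟩
  let B : (ι → ℝ) →ₗ[ℝ] (ι → ℝ) →ₗ[ℝ] ℝ := ω.compl₁₂ L L
  let η : Matrix ι ι ℝ := LinearMap.toMatrix₂' ℝ B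
  let φ : (ι → ℝ) →ₗ[ℝ] ℝ := (ω.flip e) ∘ₗ L
  let α : ι → ℝ := fun i => φ (Pi.single i 1)
  have hη : ∀ v w, ω (L v) (L w) = v ⬝ᵥ η.mulVec w := by
    intro v w
    rw [← Matrix.toLinearMap₂'_apply', Matrix.toLinearMap₂'_toMatrix']
    rfl
  have hα : ∀ v, ω (L v) e = α ⬝ᵥ v := by
    intro v
    change φ v = _
    conv_lhs => rw [← Finset.univ_sum_single v]
    rw [map_sum, dotProduct]
    refine Finset.sum_congr rfl fun i _ => ?_
    have : Pi.single i (v i) = v i • (Pi.single i 1 : ι → ℝ) := by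
      rw [← Pi.single_smul, smul_eq_mul, mul_one]
    rw [this, map_smul, smul_eq_mul, mul_comm]
  have hη' : ∀ v w, v ⬝ᵥ η.mulVec w = -(w ⬝ᵥ η.mulVec v) := by
    intro v w
    rw [← hη, ← hη, h.alt.neg_eq]
  have hsplit : ∀ x : AlmostAbelian M, x = L x.left + x.right • e := by
    intro x
    ext <;> simp [L, e, SemiDirectSum.inl]
  refine ⟨η, α, ?_, ?_, ?_⟩
  · ext i j
    have := hη' (Pi.single j 1) (Pi.single i 1)
    simpa using this
  · have hc : ∀ v w, v ⬝ᵥ (η * M + M.transpose * η).mulVec w = 0 := by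
      intro v w
      -- As the ideal is abelian, only triples containing `e₀` carry information.
      have h1 := h.closed e (L v) (L w)
      have e1 : ⁅e, L v⁆ = L (M.mulVec v) := by
        rw [AlmostAbelian.lie_def]; ext <;> simp [L, e, SemiDirectSum.inl]
      have e2 : ⁅L v, L w⁆ = 0 := by
        rw [AlmostAbelian.lie_def]; ext <;> simp [L, SemiDirectSum.inl]
      have e3 : ⁅L w, e⁆ = -L (M.mulVec w) := by
        rw [AlmostAbelian.lie_def]; ext <;> simp [L, e, SemiDirectSum.inl]
      rw [e1, e2, e3] at h1
      simp only [map_neg, map_zero, LinearMap.neg_apply, LinearMap.zero_apply, hη] at h1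
      rw [hη' (M.mulVec w)] at h1
      rw [Matrix.add_mulVec, ← Matrix.mulVec_mulVec, ← Matrix.mulVec_mulVec, dotProduct_add,
        Matrix.dotProduct_mulVec v M.transpose, Matrix.vecMul_transpose]
      linarith
    ext i j
    simpa using hc (Pi.single i 1) (Pi.single j 1)
  · intro v s h1 h2
    have hzero : L v + s • e = 0 := by
      refine h.nondegenerate.2 _ fun x => ?_
      rw [hsplit x]
      simp only [map_add, map_smul, LinearMap.add_apply, LinearMap.smul_apply, smul_eq_mul, hη, hα,
        h.alt e]
      rw [← h.alt.neg_eq, hα, h2]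
      have := congrArg (fun w => w ⬝ᵥ x.left) h1
      simp only [add_dotProduct, smul_dotProduct, zero_dotProduct, smul_eq_mul] at this
      rw [dotProduct_comm x.left]
      linarith
    refine ⟨?_, ?_⟩
    · have := congrArg SemiDirectSum.left hzero
      simpa [L, e, SemiDirectSum.inl] using this
    · have := congrArg SemiDirectSum.right hzero
      simpa [L, e, SemiDirectSum.inl] using this

theorem admitsSymplectic_iff [DecidableEq ι] (M : Matrix ι ι ℝ) :
    AdmitsSymplectic (AlmostAbelian M) ↔ ∃ η α, IsSymplecticPair M η α :=
  ⟨fun ⟨_, h⟩ => h.exists_isSymplecticPair, fun ⟨_, _, h⟩ => ⟨_, h.isSymplecticStructure⟩⟩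

/-- A change of basis acts on the form by congruence, `η ↦ Qᵀ η Q` and `α ↦ Qᵀ α`. -/
theorem IsSymplecticPair.of_areConjugate [DecidableEq ι] {κ : Type} [Fintype κ] [DecidableEq κ]
    {M : Matrix ι ι ℝ} {M' η : Matrix κ κ ℝ} {α : κ → ℝ} (hM : AreConjugate M M')
    (h : IsSymplecticPair M' η α) :
    ∃ η α, IsSymplecticPair M η α := by
  obtain ⟨P, Q, h1, h2, rfl⟩ := hM
  have h1' : Q.transpose * P.transpose = 1 := by rw [← Matrix.transpose_mul, h1]; simp
  have h2' : P.transpose * Q.transpose = 1 := by rw [← Matrix.transpose_mul, h2]; simp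
  refine ⟨Q.transpose * η * Q, Q.transpose.mulVec α, ?_, ?_, ?_⟩
  · simp [Matrix.transpose_mul, h.skew, Matrix.mul_assoc]
  · calc Q.transpose * η * Q * (P * M' * Q) + (P * M' * Q).transpose * (Q.transpose * η * Q)
        = Q.transpose * η * (Q * P) * M' * Q +
          Q.transpose * M'.transpose * (P.transpose * Q.transpose) * η * Q := by
          simp only [Matrix.transpose_mul, Matrix.mul_assoc]
      _ = Q.transpose * (η * M' + M'.transpose * η) * Q := by
          rw [h2, h2']
          simp only [Matrix.mul_add, Matrix.add_mul, Matrix.mul_assoc, Matrix.one_mul]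
      _ = 0 := by rw [h.compat]; simp
  · intro v s hv hs
    have h3 : η.mulVec (Q.mulVec v) + s • α = 0 := by
      have := congrArg P.transpose.mulVec hv
      rw [Matrix.mulVec_add, Matrix.mulVec_smul, Matrix.mulVec_mulVec, Matrix.mulVec_mulVec, h2',
        ← Matrix.mul_assoc, ← Matrix.mul_assoc, h2'] at this
      simpa using this
    have h4 : α ⬝ᵥ Q.mulVec v = 0 := by
      rw [Matrix.dotProduct_mulVec, ← Matrix.mulVec_transpose, hs]
    obtain ⟨h5, h6⟩ := h.nondeg _ _ h3 h4
    refine ⟨?_, h6⟩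
    have := congrArg P.mulVec h5
    rwa [Matrix.mulVec_mulVec, h1, Matrix.one_mulVec, Matrix.mulVec_zero] at this

theorem AreConjugate.admitsSymplectic_iff [DecidableEq ι] {κ : Type} [Fintype κ] [DecidableEq κ]
    {M : Matrix ι ι ℝ} {M' : Matrix κ κ ℝ} (hM : AreConjugate M M') :
    AdmitsSymplectic (AlmostAbelian M) ↔ AdmitsSymplectic (AlmostAbelian M') := by
  rw [_root_.admitsSymplectic_iff, _root_.admitsSymplectic_iff]
  exact ⟨fun ⟨_, _, h⟩ => h.of_areConjugate hM.symm, fun ⟨_, _, h⟩ => h.of_areConjugate hM⟩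

end SymplecticPair

/-! ### Symplectic pairs for Jordan matrices -/

section Construction

variable {κ : Type} [Fintype κ] [DecidableEq κ]

theorem sum_mul_jordanMatrix (f : κ → ℕ) (ev : κ → ℝ) (F : κ → ℕ → ℝ) (b : (x : κ) × Fin (f x)) :
    ∑ c, F c.1 c.2 * jordanMatrix f ev c b =
      F b.1 b.2 * ev b.1 + if b.2 + 1 < f b.1 then F b.1 (b.2 + 1) else 0 := by
  simp only [jordanMatrix_apply, mul_add, Finset.sum_add_distrib, mul_ite, mul_zero, mul_one,
    Finset.sum_ite_eq', Finset.mem_univ, if_true]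
  congr 1
  obtain ⟨y, j⟩ := b
  dsimp only
  split_ifs with h
  · rw [Finset.sum_eq_single ⟨y, ⟨j + 1, h⟩⟩]
    · simp
    · rintro ⟨z, l⟩ - hz
      rw [if_neg]
      rintro ⟨h1, h2⟩
      dsimp at h1 h2
      subst h1
      exact hz (by congr; exact Fin.ext h2)
    · simp
  · refine Finset.sum_eq_zero fun c _ => if_neg ?_
    rintro ⟨h1, h2⟩
    have := c.2.2
    rw [h2] at this
    exact h (h1 ▸ this)

/-- A Jordan matrix admits a symplectic pair when, after shortening the block `x₀` by one, its
blocks are matched by an involution that negates the eigenvalues, and the signs `ε` are compatible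
with the parities of the sizes. -/
theorem isSymplecticPair_jordanMatrix (f f' : κ → ℕ) (ev ε : κ → ℝ) (σ : κ → κ) (x₀ : κ)
    (hf : ∀ x, f x = f' x + if x = x₀ then 1 else 0) (hσ : ∀ x, σ (σ x) = x)
    (hfσ : ∀ x, f' (σ x) = f' x) (hev : ∀ x, 0 < f' x → ev (σ x) = -ev x) (hε : ∀ x, ε x ≠ 0)
    (hεσ : ∀ x, 0 < f' x → ε (σ x) = (-1) ^ f' x * ε x) :
    ∃ η α, IsSymplecticPair (jordanMatrix f ev) η α := by
  have hle : ∀ x, f' x ≤ f x := fun x => by rw [hf]; omega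
  -- The chain `x`, cut to length `f' x`, is paired antidiagonally with the chain `σ x`. The sign
  -- `(-1) ^ i` makes the nilpotent part skew for the form, and the condition on `ε` makes the form
  -- itself skew. Natural-number indices allow the shift past the end of a chain, where `h`
  -- vanishes.
  let h : κ → ℕ → κ → ℕ → ℝ := fun x i y j =>
    if y = σ x ∧ i + j + 1 = f' x then ε x * (-1) ^ i else 0
  have hskew : ∀ x i y j, h y j x i = -h x i y j := by
    intro x i y j
    simp only [h]
    by_cases hy : y = σ x ∧ i + j + 1 = f' x
    · obtain ⟨rfl, hij⟩ := hy
      rw [if_pos ⟨(hσ x).symm, by rw [hfσ]; omega⟩, if_pos ⟨rfl, hij⟩, hεσ _ (by omega), ← hij]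
      have : ((-1 : ℝ) ^ j) * (-1) ^ j = 1 := by rw [← mul_pow]; simp
      rw [pow_succ, pow_add]
      linear_combination (-(ε x * (-1) ^ i)) * this
    · rw [if_neg hy, if_neg, neg_zero]
      rintro ⟨rfl, hij⟩
      exact hy ⟨(hσ y).symm, by rw [hfσ]; omega⟩
  let η : Matrix ((x : κ) × Fin (f x)) ((x : κ) × Fin (f x)) ℝ :=
    fun a b => h a.1 a.2 b.1 b.2
  -- The covector dual to the last vector of the block `x₀`, the one vector that `η` pairs with
  -- nothing.
  let α : ((x : κ) × Fin (f x)) → ℝ := fun a => if a.1 = x₀ ∧ a.2.val = f' x₀ then 1 else 0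
  have hηskew : η.transpose = -η := by
    ext a b
    exact hskew _ _ _ _
  have hmul : ∀ a b, (η * jordanMatrix f ev) a b =
      h a.1 a.2 b.1 b.2 * ev b.1 + h a.1 a.2 b.1 (b.2 + 1) := by
    intro a b
    rw [Matrix.mul_apply]
    refine (sum_mul_jordanMatrix f ev (h a.1 a.2) b).trans ?_
    congr 1
    split_ifs with hb
    · rfl
    · symm
      refine if_neg ?_
      rintro ⟨h1, h2⟩
      have := hle b.1
      rw [h1, hfσ, ← h1] at this
      omega
  refine ⟨η, α, hηskew, ?_, ?_⟩
  · have hT : (jordanMatrix f ev).transpose * η = -(η * jordanMatrix f ev).transpose := by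
      rw [Matrix.transpose_mul, hηskew, Matrix.mul_neg, neg_neg]
    rw [hT]
    ext a b
    rw [Matrix.add_apply, Matrix.neg_apply, Matrix.transpose_apply, hmul, hmul,
      hskew a.1 a.2 b.1 b.2, hskew a.1 (a.2 + 1) b.1 b.2]
    have e1 : h a.1 a.2 b.1 b.2 * ev b.1 = -(h a.1 a.2 b.1 b.2 * ev a.1) := by
      simp only [h]
      split_ifs with hab
      · rw [hab.1, hev _ (by omega)]; ring
      · simp
    have e2 : h a.1 a.2 b.1 (b.2 + 1) = -h a.1 (a.2 + 1) b.1 b.2 := by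
      simp only [h]
      have : (a.2 + 1 + b.2 + 1 : ℕ) = a.2 + (b.2 + 1) + 1 := by ring
      rw [this]
      split_ifs
      · rw [pow_succ]; ring
      · simp
    rw [Matrix.zero_apply]
    linear_combination e1 + e2
  · intro v s hv hs
    -- The row of `η` at the partner index `f' x - 1 - i` of the chain `σ x` has its only non-zero
    -- entry at `(x, i)`, and `α` vanishes there.
    have hlow : ∀ (x : κ) (i : Fin (f x)), i.val < f' x → v ⟨x, i⟩ = 0 := by
      intro x i hi
      have hlt : f' x - 1 - i < f (σ x) := by
        have := hle (σ x)
        rw [hfσ] at this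
        omega
      have := congrFun hv ⟨σ x, ⟨f' x - 1 - i, hlt⟩⟩
      rw [Pi.add_apply, Matrix.mulVec, dotProduct, Finset.sum_eq_single ⟨x, i⟩] at this
      · have h1 : η ⟨σ x, ⟨f' x - 1 - i, hlt⟩⟩ ⟨x, i⟩ = ε (σ x) * (-1) ^ (f' x - 1 - i.val) :=
          if_pos ⟨(hσ x).symm, by rw [hfσ]; dsimp; omega⟩
        have h2 : α ⟨σ x, ⟨f' x - 1 - i, hlt⟩⟩ = 0 := by
          refine if_neg ?_
          rintro ⟨h1, h2⟩
          dsimp at h1 h2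
          rw [← h1, hfσ] at h2
          omega
        rw [Pi.smul_apply, h1, h2, smul_zero, add_zero, Pi.zero_apply] at this
        exact (mul_eq_zero.1 this).resolve_left (mul_ne_zero (hε _) (by simp))
      · rintro ⟨y, j⟩ - hne
        have : η ⟨σ x, ⟨f' x - 1 - i, hlt⟩⟩ ⟨y, j⟩ = 0 := by
          refine if_neg ?_
          rintro ⟨h1, h2⟩
          dsimp at h1 h2
          rw [hσ] at h1
          subst h1
          rw [hfσ] at h2
          exact hne (by congr; apply Fin.ext; omega)
        rw [this, zero_mul]
      · simp
    have hx₀ : f' x₀ < f x₀ := by rw [hf]; simp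
    have htop : v ⟨x₀, ⟨f' x₀, hx₀⟩⟩ = 0 := by
      rw [dotProduct, Finset.sum_eq_single ⟨x₀, ⟨f' x₀, hx₀⟩⟩] at hs
      · simpa [α] using hs
      · rintro ⟨y, j⟩ - hne
        have : α ⟨y, j⟩ = 0 := by
          refine if_neg ?_
          rintro ⟨h1, h2⟩
          dsimp at h1 h2
          subst h1
          exact hne (by congr; apply Fin.ext; omega)
        rw [this, zero_mul]
      · simp
    have hv0 : v = 0 := by
      ext ⟨x, i⟩
      by_cases hi : i.val < f' x
      · exact hlow x i hi
      · have hi2 := i.2.trans_eq (hf x)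
        by_cases hx : x = x₀
        · subst hx
          have : i = ⟨f' x, hx₀⟩ := Fin.ext (by rw [if_pos rfl] at hi2; dsimp; omega)
          rw [this]
          exact htop
        · rw [if_neg hx] at hi2
          omega
    refine ⟨hv0, ?_⟩
    have := congrFun hv ⟨x₀, ⟨f' x₀, hx₀⟩⟩
    simpa [hv0, α] using this

end Construction

/-! ### The pairings of blocks used in the two cases. -/

section Construction

/-- If exactly one of the sizes `n i` is odd with odd multiplicity `p i`, the nilpotent Jordan
matrix with `p i` blocks of size `n i` for every `i` gives a symplectic almost abelian algebra. -/
theorem admitsSymplectic_jordanMatrix_zero {I : Type} [Fintype I] [DecidableEq I] (n p : I → ℕ)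
    (h : ∃! i, Odd (n i) ∧ Odd (p i)) :
    AdmitsSymplectic (AlmostAbelian
      (jordanMatrix (fun x : (i : I) × Fin (p i) => n x.1) fun _ => 0)) := by
  obtain ⟨i₀, ⟨hn, hp⟩, huniq⟩ := h
  rw [admitsSymplectic_iff]
  have hp' : (p i₀ - 1) / 2 < p i₀ := by obtain ⟨q, hq⟩ := hp; omega
  -- The middle block of the exceptional family. The reversal below fixes it, and after losing one
  -- vector it has even size, so it can be paired with itself.
  let x₀ : (i : I) × Fin (p i) := ⟨i₀, ⟨(p i₀ - 1) / 2, hp'⟩⟩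
  -- Blocks of even size are self-paired; those of odd size cannot be, and are matched by reversing
  -- their order within the family.
  let σ : ((i : I) × Fin (p i)) → ((i : I) × Fin (p i)) := fun x =>
    if Odd (n x.1) then ⟨x.1, x.2.rev⟩ else x
  have hσx₀ : ∀ x, σ x = x₀ ↔ x = x₀ := by
    have h1 : σ x₀ = x₀ := by
      simp only [σ, x₀, if_pos hn]
      congr 1
      apply Fin.ext
      rw [Fin.val_rev]
      obtain ⟨q, hq⟩ := hp
      dsimp
      omega
    have hσ : ∀ x, σ (σ x) = x := by
      rintro ⟨i, j⟩
      by_cases hi : Odd (n i) <;> simp [σ, hi]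
    intro x
    constructor
    · intro h; rw [← hσ x, h, h1]
    · rintro rfl; exact h1
  have hσ1 : ∀ x, (σ x).1 = x.1 := by
    rintro ⟨i, j⟩
    by_cases hi : Odd (n i) <;> simp [σ, hi]
  refine isSymplecticPair_jordanMatrix _ (fun x => n x.1 - if x = x₀ then 1 else 0) _
    -- Partners of odd size need opposite signs: -1 on the first half of such a family, 1 on the
    -- second.
    (fun x => if Odd (n x.1) ∧ 2 * x.2.val + 1 < p x.1 then -1 else 1) σ x₀ ?_ ?_ ?_ ?_ ?_ ?_
  · intro x
    split_ifs with hx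
    · subst hx
      have := hn.pos
      dsimp [x₀]
      omega
    · rfl
  · rintro ⟨i, j⟩
    by_cases hi : Odd (n i) <;> simp [σ, hi]
  · intro x
    simp only [hσ1, hσx₀]
  · simp
  · intro x
    split_ifs <;> norm_num
  · rintro ⟨i, j⟩ -
    by_cases hi : Odd (n i)
    · by_cases hx : (⟨i, j⟩ : (i : I) × Fin (p i)) = x₀
      · rw [(hσx₀ _).2 hx, hx, if_pos rfl, Even.neg_one_pow, one_mul]
        exact Nat.Odd.sub_odd hn odd_one
      · rw [if_neg hx, Nat.sub_zero, Odd.neg_one_pow hi]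
        -- Another fixed block of odd size would be the middle of a second family with odd size and
        -- odd multiplicity.
        have hj : 2 * j.val + 1 ≠ p i := by
          intro hj
          obtain rfl := huniq i ⟨hi, ⟨j, hj.symm⟩⟩
          apply hx
          simp only [x₀]
          congr 1
          apply Fin.ext
          dsimp
          omega
        have hjlt := j.2
        have hσij : σ ⟨i, j⟩ = ⟨i, j.rev⟩ := if_pos hi
        rw [hσij]
        simp only [Fin.val_rev, hi, true_and]
        by_cases h1 : 2 * j.val + 1 < p i
        · rw [if_pos h1, if_neg (by omega)]; norm_num
        · rw [if_neg h1, if_pos (by omega)]; norm_num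
    · have hx : (⟨i, j⟩ : (i : I) × Fin (p i)) ≠ x₀ := by
        rintro h
        apply hi
        have := congrArg (fun x : (i : I) × Fin (p i) => n x.1) h
        dsimp [x₀] at this
        rwa [this]
      rw [if_neg hx, Nat.sub_zero, Even.neg_one_pow (Nat.not_odd_iff_even.1 hi)]
      simp [σ, hi]

/-- Enlarging by one a block of a Jordan matrix with eigenvalue `-c` and pairing it with the
resulting Jordan matrix with eigenvalue `c` gives a symplectic almost abelian algebra. -/
theorem admitsSymplectic_jordanMatrix_sum {κ : Type} [Fintype κ] [DecidableEq κ] (f g : κ → ℕ)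
    (c : ℝ) (x₀ : κ) (h : ∀ x, f x = g x + if x = x₀ then 1 else 0) :
    AdmitsSymplectic (AlmostAbelian
      (jordanMatrix (Sum.elim f g) (Sum.elim (fun _ => c) fun _ => -c))) := by
  rw [admitsSymplectic_iff]
  -- Each block is paired with its copy at the opposite eigenvalue; putting `(-1) ^ g x` on one side
  -- only satisfies the sign rule in both directions.
  refine isSymplecticPair_jordanMatrix _ (Sum.elim g g) _
    (Sum.elim (fun _ => 1) fun x => (-1) ^ g x) Sum.swap (Sum.inl x₀) ?_ ?_ ?_ ?_ ?_ ?_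
  · rintro (x | x) <;> simp [h]
  · simp
  · rintro (x | x) <;> simp
  · rintro (x | x) <;> simp
  · rintro (x | x) <;> simp
  · rintro (x | x) <;> simp [← mul_pow]

end Construction

/-! ### Rank conditions for symplectic pairs -/

section Rank

open Module

variable {ι κ : Type} [Fintype ι] [Fintype κ]

/-- On a complement of the kernel the form has an invertible skew Gram matrix, and `det S = (-1) ^ r
det S` forces its size `r` to be even. -/
theorem Matrix.even_rank_of_skew {η : Matrix ι ι ℝ} (h : η.transpose = -η) : Even η.rank := by
  classical
  obtain ⟨W, hW⟩ := Submodule.exists_isCompl (LinearMap.ker η.mulVecLin)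
  have hdim : finrank ℝ W = η.rank := by
    have h1 := Submodule.finrank_add_eq_of_isCompl hW
    have h2 := LinearMap.finrank_range_add_finrank_ker η.mulVecLin
    rw [Matrix.rank]
    omega
  let b := finBasis ℝ W
  let S : Matrix (Fin (finrank ℝ W)) (Fin (finrank ℝ W)) ℝ :=
    Matrix.of fun i j => (b i : ι → ℝ) ⬝ᵥ η.mulVec (b j)
  have hS : S.transpose = -S := by
    ext i j
    exact Matrix.dotProduct_mulVec_skew h _ _
  have hdet : S.det ≠ 0 := by
    intro hdet
    obtain ⟨c, hc, hSc⟩ := Matrix.exists_mulVec_eq_zero_iff.2 hdet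
    set w : W := ∑ j, c j • b j with hw
    have h1 : ∀ i, (b i : ι → ℝ) ⬝ᵥ η.mulVec w = 0 := by
      intro i
      have := congrFun hSc i
      rw [Matrix.mulVec, dotProduct] at this
      rw [hw, AddSubmonoidClass.coe_finsetSum, Matrix.mulVec_sum, dotProduct_sum]
      rw [Pi.zero_apply] at this
      rw [← this]
      refine Finset.sum_congr rfl fun j _ => ?_
      rw [Submodule.coe_smul, Matrix.mulVec_smul, dotProduct_smul, smul_eq_mul, mul_comm]
      rfl
    have h2 : ∀ u : W, (u : ι → ℝ) ⬝ᵥ η.mulVec w = 0 := by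
      intro u
      rw [← b.sum_repr u, AddSubmonoidClass.coe_finsetSum, sum_dotProduct]
      refine Finset.sum_eq_zero fun i _ => ?_
      rw [Submodule.coe_smul, smul_dotProduct, h1, smul_zero]
    have h3 : η.mulVec w = 0 := by
      refine dotProduct_eq_zero_iff.1 fun u => ?_
      rw [dotProduct_comm]
      obtain ⟨k, hk, u', hu', rfl⟩ :=
        Submodule.mem_sup.1 (hW.sup_eq_top ▸ Submodule.mem_top : u ∈ _ ⊔ W)
      rw [add_dotProduct, h2 ⟨u', hu'⟩, Matrix.dotProduct_mulVec_skew h k]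
      rw [LinearMap.mem_ker, Matrix.mulVecLin_apply] at hk
      simp [hk]
    have h4 : w = 0 := by
      have : (w : ι → ℝ) ∈ LinearMap.ker η.mulVecLin ⊓ W := ⟨h3, w.2⟩
      rw [hW.inf_eq_bot, Submodule.mem_bot] at this
      exact Subtype.ext this
    apply hc
    funext j
    have := congrArg (fun w => b.repr w j) h4
    simpa [hw, Finsupp.single_apply] using this
  have h5 := congrArg Matrix.det hS
  rw [Matrix.det_transpose, Matrix.det_neg, Fintype.card_fin] at h5
  rw [← hdim]
  rcases Nat.even_or_odd (finrank ℝ W) with he | ho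
  · exact he
  · rw [ho.neg_one_pow] at h5
    exact absurd (by linarith) hdet

/-- Rank–nullity for `A` restricted to the range of `B`. -/
theorem Matrix.rank_mul_add_finrank_inf_ker {τ : Type} [Fintype τ]
    (A : Matrix τ κ ℝ) (B : Matrix κ ι ℝ) :
    (A * B).rank + finrank ℝ ↥(LinearMap.range B.mulVecLin ⊓ LinearMap.ker A.mulVecLin) =
      B.rank := by
  have h := LinearMap.finrank_range_add_finrank_ker
    (A.mulVecLin.domRestrict (LinearMap.range B.mulVecLin))
  rw [Matrix.rank, Matrix.rank, ← h, Matrix.mulVecLin_mul, LinearMap.range_comp,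
    LinearMap.range_domRestrict]
  congr 1
  rw [LinearMap.ker_domRestrict, ← Submodule.map_comap_subtype, Submodule.finrank_map_subtype_eq]

/-- The dimensions decrease with `k` from 1, at `k = 0`, to 0 by nilpotency; `h` is the last
exponent before the drop. -/
theorem IsNilpotent.exists_finrank_range_pow_inf [DecidableEq ι] {N : Matrix ι ι ℝ}
    (hN : IsNilpotent N) {K : Submodule ℝ (ι → ℝ)} (hK : finrank ℝ K = 1) :
    ∃ h : ℕ, ∀ k, finrank ℝ ↥(LinearMap.range (N ^ k).mulVecLin ⊓ K) = if k ≤ h then 1 else 0 := by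
  set d : ℕ → ℕ := fun k => finrank ℝ ↥(LinearMap.range (N ^ k).mulVecLin ⊓ K) with hd
  have hle : ∀ k, d k ≤ 1 := fun k => hK ▸ Submodule.finrank_mono inf_le_right
  have hanti : Antitone d := by
    refine antitone_nat_of_succ_le fun k => Submodule.finrank_mono (inf_le_inf_right _ ?_)
    rw [_root_.pow_succ, Matrix.mulVecLin_mul]
    exact LinearMap.range_comp_le_range _ _
  have h0 : d 0 = 1 := by
    have : LinearMap.range (N ^ 0).mulVecLin ⊓ K = K := by simp
    rw [hd, ← hK]
    dsimp only
    rw [this]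
  obtain ⟨m, hm⟩ := hN
  have hex : ∃ k, d k = 0 := ⟨m, by simp [hd, hm]⟩
  classical
  have hfind := Nat.find_spec hex
  refine ⟨Nat.find hex - 1, fun k => ?_⟩
  change d k = _
  have hpos : Nat.find hex ≠ 0 := by
    intro h
    rw [h, h0] at hfind
    exact one_ne_zero hfind
  split_ifs with hk
  · have := Nat.find_min hex (m := k) (by omega)
    have := hle k
    omega
  · have := hanti (show Nat.find hex ≤ k by omega)
    omega

/-- As the sums are ranks of powers of a nilpotent Jordan matrix, this recovers the number of blocks
of size `k + 1` as a second difference of ranks. -/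
theorem sum_tsub_add_sum_tsub (f : κ → ℕ) (k : ℕ) :
    ∑ x, (f x - k) + ∑ x, (f x - (k + 2)) =
      2 * ∑ x, (f x - (k + 1)) + Fintype.card {x // f x = k + 1} := by
  rw [Fintype.card_subtype, Finset.card_filter, Finset.mul_sum, ← Finset.sum_add_distrib,
    ← Finset.sum_add_distrib]
  refine Finset.sum_congr rfl fun x _ => ?_
  split_ifs <;> omega

theorem finrank_le_one_of_dotProduct {K : Submodule ℝ (ι → ℝ)} (α : ι → ℝ)
    (h : ∀ v ∈ K, α ⬝ᵥ v = 0 → v = 0) : finrank ℝ K ≤ 1 := by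
  rw [← finrank_self ℝ]
  refine LinearMap.finrank_le_finrank_of_injective (f := (dotProductBilin ℝ ℝ α).domRestrict K) ?_
  rw [← LinearMap.ker_eq_bot, LinearMap.ker_eq_bot']
  exact fun v hv => Subtype.ext (h v v.2 hv)

/-- The parity obstruction of the nilpotent case: `η` and the even products `η M ^ (2j)` are skew,
hence of even rank. -/
theorem IsSymplecticPair.odd_card [DecidableEq ι] [DecidableEq κ] {M η : Matrix ι ι ℝ} {α : ι → ℝ}
    (h : IsSymplecticPair M η α) (hι : Odd (Fintype.card ι)) {f : κ → ℕ}
    (hM : AreConjugate M (jordanMatrix f fun _ => 0)) :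
    ∃! k, Odd k ∧ Odd (Fintype.card {x // f x = k}) := by
  have hr : ∀ k, (M ^ k).rank = ∑ x, (f x - k) := fun k =>
    (hM.pow k).rank_eq.trans (rank_jordanMatrix_pow f k)
  have hnil : IsNilpotent M := by
    refine ⟨∑ x, f x, (hM.pow _).eq_zero (jordanMatrix_pow_eq_zero f _ fun x => ?_)⟩
    exact Finset.single_le_sum (f := f) (fun _ _ => Nat.zero_le _) (Finset.mem_univ x)
  have hK : finrank ℝ (LinearMap.ker η.mulVecLin) = 1 := by
    have h1 := LinearMap.finrank_range_add_finrank_ker η.mulVecLin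
    rw [finrank_fintype_fun_eq_card] at h1
    obtain ⟨q, hq⟩ := Matrix.even_rank_of_skew h.skew
    rw [Matrix.rank] at hq
    have h2 : finrank ℝ (LinearMap.ker η.mulVecLin) ≤ 1 := by
      refine finrank_le_one_of_dotProduct α fun v hv hα => (h.nondeg v 0 ?_ hα).1
      rw [LinearMap.mem_ker, Matrix.mulVecLin_apply] at hv
      simp [hv]
    obtain ⟨p, hp⟩ := hι
    omega
  obtain ⟨h0, hh0⟩ := hnil.exists_finrank_range_pow_inf hK
  have hpow : ∀ k, M.transpose ^ k * η = (-1 : ℝ) ^ k • (η * M ^ k) := by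
    intro k
    induction k with
    | zero => simp
    | succ k ih =>
      have h1 : M.transpose * η = -(η * M) := eq_neg_of_add_eq_zero_right h.compat
      rw [pow_succ, Matrix.mul_assoc, h1, Matrix.mul_neg, ← Matrix.mul_assoc, ih, pow_succ,
        pow_succ, Matrix.smul_mul, Matrix.mul_assoc]
      simp
  have heven : ∀ j, Even ((η * M ^ (2 * j)).rank) := by
    intro j
    apply Matrix.even_rank_of_skew
    rw [Matrix.transpose_mul, Matrix.transpose_pow, h.skew, Matrix.mul_neg, hpow]
    simp
  have hcard : ∀ j, Odd (Fintype.card {x // f x = 2 * j + 1}) ↔ 2 * j ≤ h0 ∧ h0 < 2 * j + 2 := by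
    intro j
    have h1 := sum_tsub_add_sum_tsub f (2 * j)
    have h2 := Matrix.rank_mul_add_finrank_inf_ker η (M ^ (2 * j))
    have h3 := Matrix.rank_mul_add_finrank_inf_ker η (M ^ (2 * (j + 1)))
    rw [hh0, hr] at h2 h3
    obtain ⟨q, hq⟩ := heven j
    obtain ⟨q', hq'⟩ := heven (j + 1)
    rw [← h2, show 2 * j + 2 = 2 * (j + 1) by ring, ← h3, hq, hq'] at h1
    rw [Nat.odd_iff]
    split_ifs at h1 <;> omega
  -- The only odd `2j + 1` with `2j ≤ h0 < 2j + 2`.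
  refine ⟨2 * (h0 / 2) + 1, ⟨by simp, (hcard _).2 (by omega)⟩, ?_⟩
  rintro k ⟨⟨j, rfl⟩, hk⟩
  have := (hcard j).1 hk
  omega

/-- The Sylvester equation `N' X + X N = c X` with `N`, `N'` nilpotent and `c ≠ 0` has only the zero
solution. -/
theorem Matrix.eq_zero_of_nilpotent_sylvester [DecidableEq ι] [DecidableEq κ] {N : Matrix ι ι ℝ}
    {N' : Matrix κ κ ℝ} (hN : IsNilpotent N) (hN' : IsNilpotent N') {c : ℝ} (hc : c ≠ 0)
    {X : Matrix κ ι ℝ} (h : N' * X + X * N = c • X) : X = 0 := by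
  -- Iterating gives `X (c - N) ^ m = N' ^ m X`, which is 0 for large `m`, while `c - N` is
  -- invertible.
  have h1 : X * (c • 1 - N) = N' * X := by
    rw [Matrix.mul_sub, Matrix.mul_smul, Matrix.mul_one, ← h]; abel
  have h2 : ∀ k, X * (c • 1 - N) ^ k = N' ^ k * X := by
    intro k
    induction k with
    | zero => simp
    | succ k ih => rw [pow_succ, ← Matrix.mul_assoc, ih, Matrix.mul_assoc, h1, pow_succ,
        Matrix.mul_assoc]
  obtain ⟨m, hm⟩ := hN'
  have hu : IsUnit (c • (1 : Matrix ι ι ℝ) - N) := by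
    rw [sub_eq_add_neg]
    refine hN.neg.isUnit_add_left_of_commute ?_ ?_
    · exact (Algebra.algebraMap_eq_smul_one (A := Matrix ι ι ℝ) c) ▸
        (IsUnit.mk0 c hc).map (algebraMap ℝ (Matrix ι ι ℝ))
    · exact (Commute.one_right _).smul_right c
  obtain ⟨u, hu⟩ := hu.pow m
  have h3 := h2 m
  rw [hm, Matrix.zero_mul, ← hu] at h3
  calc X = X * ((u : Matrix ι ι ℝ) * ((u⁻¹ : (Matrix ι ι ℝ)ˣ) : Matrix ι ι ℝ)) := by simp
    _ = 0 := by rw [← Matrix.mul_assoc, h3, Matrix.zero_mul]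

/-- Sums of equal eigenvalues, `2c` and `-2c`, are non-zero, so `η` can only pair the two
generalized eigenspaces with each other. The pairing `H'` is surjective with one-dimensional kernel,
and `H' N ^ k = (-N'ᵀ) ^ k H'` compares the ranks. -/
theorem IsSymplecticPair.exists_rank_eq [DecidableEq ι] [DecidableEq κ]
    (hcard : Fintype.card ι = Fintype.card κ + 1) {N : Matrix ι ι ℝ} {N' : Matrix κ κ ℝ} {c : ℝ}
    (hc : c ≠ 0) (hA : IsNilpotent N) (hB : IsNilpotent N')
    {η : Matrix (ι ⊕ κ) (ι ⊕ κ) ℝ} {α : ι ⊕ κ → ℝ}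
    (h : IsSymplecticPair (Matrix.fromBlocks (N + c • 1) 0 0 (N' + (-c) • 1)) η α) :
    ∃ h : ℕ, ∀ k, (N ^ k).rank = (N' ^ k).rank + if k ≤ h then 1 else 0 := by
  obtain ⟨X, H, H', Y, rfl⟩ : ∃ X H H' Y, η = Matrix.fromBlocks X H H' Y :=
    ⟨_, _, _, _, (Matrix.fromBlocks_toBlocks η).symm⟩
  have h1 := h.skew
  have h2 := h.compat
  rw [Matrix.fromBlocks_transpose, Matrix.fromBlocks_neg, Matrix.fromBlocks_inj] at h1
  rw [Matrix.fromBlocks_transpose, Matrix.fromBlocks_multiply, Matrix.fromBlocks_multiply,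
    Matrix.fromBlocks_add, ← Matrix.fromBlocks_zero, Matrix.fromBlocks_inj] at h2
  simp only [Matrix.mul_zero, Matrix.zero_mul, add_zero, zero_add, Matrix.transpose_zero] at h2
  obtain ⟨-, hH', -, -⟩ := h1
  obtain ⟨hX, -, hH, hY⟩ := h2
  have hNT : ∀ {ι : Type} [Fintype ι] [DecidableEq ι] {N : Matrix ι ι ℝ}, IsNilpotent N →
      IsNilpotent N.transpose := by
    rintro ι _ _ N ⟨m, hm⟩
    exact ⟨m, by rw [← Matrix.transpose_pow, hm, Matrix.transpose_zero]⟩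
  have hX0 : X = 0 := by
    refine Matrix.eq_zero_of_nilpotent_sylvester hA (hNT hA) (c := -2 * c) (by simpa using hc) ?_
    simp only [Matrix.transpose_add, Matrix.transpose_smul, Matrix.transpose_one, Matrix.mul_add,
      Matrix.add_mul, Matrix.mul_smul, Matrix.smul_mul, Matrix.mul_one, Matrix.one_mul] at hX
    rw [← sub_eq_zero, ← hX]
    module
  have hY0 : Y = 0 := by
    refine Matrix.eq_zero_of_nilpotent_sylvester hB (hNT hB) (c := 2 * c) (by simpa using hc) ?_
    simp only [Matrix.transpose_add, Matrix.transpose_smul, Matrix.transpose_one, Matrix.mul_add,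
      Matrix.add_mul, Matrix.mul_smul, Matrix.smul_mul, Matrix.mul_one, Matrix.one_mul] at hY
    rw [← sub_eq_zero, ← hY]
    module
  have hG : H' * N = (-N'.transpose) * H' := by
    simp only [Matrix.transpose_add, Matrix.transpose_smul, Matrix.transpose_one, Matrix.mul_add,
      Matrix.add_mul, Matrix.mul_smul, Matrix.smul_mul, Matrix.mul_one, Matrix.one_mul] at hH
    rw [← sub_eq_zero, ← hH, Matrix.neg_mul]
    module
  have hGpow : ∀ k, H' * N ^ k = (-N'.transpose) ^ k * H' := by
    intro k
    induction k with
    | zero => simp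
    | succ k ih => rw [_root_.pow_succ, ← Matrix.mul_assoc, ih, Matrix.mul_assoc, hG,
        _root_.pow_succ, Matrix.mul_assoc]
  -- As `X = 0`, the kernel of `H'` embeds into `ker η`, where `α` is injective.
  have hle : finrank ℝ (LinearMap.ker H'.mulVecLin) ≤ 1 := by
    refine finrank_le_one_of_dotProduct (α ∘ Sum.inl) fun v hv hα => ?_
    rw [LinearMap.mem_ker, Matrix.mulVecLin_apply] at hv
    have := (h.nondeg (Sum.elim v 0) 0 ?_ ?_).1
    · funext i
      exact congrFun this (Sum.inl i)
    · rw [hX0, hY0, Matrix.fromBlocks_mulVec]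
      simp [hv]
    · rw [← hα]
      simp [dotProduct]
  have hrk := LinearMap.finrank_range_add_finrank_ker H'.mulVecLin
  rw [finrank_fintype_fun_eq_card, hcard] at hrk
  have hrange : finrank ℝ (LinearMap.range H'.mulVecLin) ≤ finrank ℝ (κ → ℝ) :=
    Submodule.finrank_le _
  rw [finrank_fintype_fun_eq_card] at hrange
  have hsurj : LinearMap.range H'.mulVecLin = ⊤ := by
    apply Submodule.eq_top_of_finrank_eq
    rw [finrank_fintype_fun_eq_card]
    omega
  obtain ⟨h0, hh0⟩ := hA.exists_finrank_range_pow_inf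
    (K := LinearMap.ker H'.mulVecLin) (by omega)
  refine ⟨h0, fun k => ?_⟩
  rw [← Matrix.rank_mul_add_finrank_inf_ker H' (N ^ k), hh0, hGpow]
  congr 1
  rw [Matrix.rank, Matrix.mulVecLin_mul, LinearMap.range_comp_of_range_eq_top _ hsurj,
    ← Matrix.rank, ← Matrix.rank_transpose (N' ^ k), Matrix.transpose_pow]
  rw [neg_pow]
  rcases neg_one_pow_eq_or (Matrix κ κ ℝ) k with h | h
  · rw [h, Matrix.one_mul]
  · have : (-N'.transpose ^ k).mulVecLin = -(N'.transpose ^ k).mulVecLin := by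
      ext1; simp
    rw [h, neg_one_mul, Matrix.rank, Matrix.rank, this, LinearMap.range_neg]

end Rank

/-! ### Jordan tuples and block counts -/

/-- The number of Jordan blocks of size `k`, when the sizes are given by `f`. -/
def sizeCount {κ : Type} [Fintype κ] (f : κ → ℕ) (k : ℕ) : ℕ := Fintype.card {x // f x = k}

theorem sizeCount_eq_sum {κ : Type} [Fintype κ] (f : κ → ℕ) (k : ℕ) :
    sizeCount f k = ∑ x, if f x = k then 1 else 0 := by
  rw [sizeCount, Fintype.card_subtype, Finset.card_filter]

/-- The ranks of the powers of the nilpotent part determine the counts. Only positive sizes appear,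
since empty blocks are invisible to the matrix. -/
theorem areConjugate_jordanMatrix_iff {κ κ' : Type} [Fintype κ] [DecidableEq κ] [Fintype κ']
    [DecidableEq κ'] (f : κ → ℕ) (g : κ' → ℕ) (b : ℝ) :
    AreConjugate (jordanMatrix f fun _ => b) (jordanMatrix g fun _ => b) ↔
      ∀ k, sizeCount f (k + 1) = sizeCount g (k + 1) := by
  refine ⟨fun h k => ?_, AreConjugate.jordanMatrix_of_card b⟩
  have h1 := h.sub_smul_one b
  rw [jordanMatrix_sub_smul_one, jordanMatrix_sub_smul_one] at h1
  have h2 : ∀ k, ∑ x, (f x - k) = ∑ y, (g y - k) := fun k => by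
    rw [← rank_jordanMatrix_pow, (h1.pow k).rank_eq, rank_jordanMatrix_pow]
  have h3 := sum_tsub_add_sum_tsub f k
  have h4 := sum_tsub_add_sum_tsub g k
  rw [h2, h2, h2, h4] at h3
  exact (Nat.add_left_cancel h3).symm

theorem HasSingleEigenvalue.exists_areConjugate {ι : Type} [Fintype ι] [DecidableEq ι]
    {A : Matrix ι ι ℝ} {b : ℝ} (h : HasSingleEigenvalue A b) :
    ∃ (d : ℕ) (f : Fin d → ℕ), AreConjugate A (jordanMatrix f fun _ => b) := by
  obtain ⟨d, f, hf⟩ := h.isNilpotent_sub.exists_areConjugate_jordanMatrix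
  refine ⟨d, f, ?_⟩
  have := hf.sub_smul_one (-b)
  rw [← jordanMatrix_sub_smul_one f b] at this
  simpa using this

/-- The total multiplicity of `k` in a list of sizes with multiplicities. -/
def listCount (l : List (ℕ × ℕ)) (k : ℕ) : ℕ := (l.map fun x => if x.1 = k then x.2 else 0).sum

section ListCount

@[simp] theorem listCount_nil (k : ℕ) : listCount [] k = 0 := rfl

@[simp] theorem listCount_cons (x : ℕ × ℕ) (l : List (ℕ × ℕ)) (k : ℕ) :
    listCount (x :: l) k = (if x.1 = k then x.2 else 0) + listCount l k := by
  simp [listCount]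

@[simp] theorem listCount_append (l l' : List (ℕ × ℕ)) (k : ℕ) :
    listCount (l ++ l') k = listCount l k + listCount l' k := by
  simp [listCount]

theorem listCount_dropZero (l : List (ℕ × ℕ)) (k : ℕ) :
    listCount (dropZero l) k = listCount l k := by
  induction l with
  | nil => rfl
  | cons x l ih =>
    rw [dropZero] at ih ⊢
    rw [List.filter_cons]
    split_ifs with h
    · rw [listCount_cons, listCount_cons, ih]
    · have : x.2 = 0 := by simpa using h
      rw [ih, listCount_cons, this, ite_self, zero_add]

theorem listCount_eq_zero {l : List (ℕ × ℕ)} {k : ℕ} (h : ∀ x ∈ l, x.1 ≠ k) :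
    listCount l k = 0 := by
  induction l with
  | nil => rfl
  | cons x l ih =>
    rw [listCount_cons, if_neg (h x (by simp)), ih fun y hy => h y (by simp [hy])]

theorem exists_get_of_listCount_ne_zero {l : List (ℕ × ℕ)} {k : ℕ} (h : listCount l k ≠ 0) :
    ∃ i : Fin l.length, (l.get i).1 = k := by
  by_contra! hne
  refine h (listCount_eq_zero fun x hx => ?_)
  obtain ⟨i, rfl⟩ := List.get_of_mem hx
  exact hne i

theorem listCount_get {l : List (ℕ × ℕ)} (hl : l.Pairwise fun x y => y.1 < x.1)
    (i : Fin l.length) : listCount l (l.get i).1 = (l.get i).2 := by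
  induction l with
  | nil => exact i.elim0
  | cons x l ih =>
    rw [List.pairwise_cons] at hl
    refine Fin.cases ?_ (fun i => ?_) i
    · rw [listCount_cons]
      have : listCount l x.1 = 0 := listCount_eq_zero fun y hy => (hl.1 y hy).ne
      simp [this]
    · have h1 := hl.1 _ (l.get_mem i)
      have h2 := ih hl.2 i
      rw [listCount_cons]
      change (if x.1 = (l.get i).1 then x.2 else 0) + listCount l (l.get i).1 = (l.get i).2
      rw [if_neg h1.ne', zero_add, h2]

theorem get_fst_injective {l : List (ℕ × ℕ)} (hl : l.Pairwise fun x y => y.1 < x.1) :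
    Function.Injective fun i : Fin l.length => (l.get i).1 := by
  intro i j hij
  rw [List.pairwise_iff_get] at hl
  rcases lt_trichotomy i j with h | h | h
  · exact absurd hij (hl i j h).ne'
  · exact h
  · exact absurd hij (hl j i h).ne

/-- Induction on the bound: the new largest size is prepended when its count is positive, which
keeps the list strictly decreasing. -/
theorem exists_list_of_count (μ : ℕ → ℕ) (m : ℕ) :
    ∃ l : List (ℕ × ℕ), l.Pairwise (fun x y => y.1 < x.1) ∧
      (∀ x ∈ l, 2 ≤ x.1 ∧ 0 < x.2 ∧ x.1 ≤ m) ∧ ∀ k, 2 ≤ k → k ≤ m → listCount l k = μ k := by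
  induction m with
  | zero => exact ⟨[], by simp, by simp, fun k h1 h2 => by omega⟩
  | succ m ih =>
    obtain ⟨l, h1, h2, h3⟩ := ih
    have h4 : listCount l (m + 1) = 0 := listCount_eq_zero fun x hx => by
      have := h2 x hx; omega
    by_cases hm : 2 ≤ m + 1 ∧ 0 < μ (m + 1)
    · refine ⟨(m + 1, μ (m + 1)) :: l, ?_, ?_, ?_⟩
      · rw [List.pairwise_cons]
        exact ⟨fun x hx => Nat.lt_succ_of_le (h2 x hx).2.2, h1⟩
      · intro x hx
        rcases List.mem_cons.1 hx with rfl | hx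
        · exact ⟨hm.1, hm.2, le_rfl⟩
        · have := h2 x hx
          omega
      · intro k hk hkm
        rw [listCount_cons]
        rcases Nat.lt_or_eq_of_le hkm with h | rfl
        · rw [if_neg (by dsimp; omega), zero_add, h3 k hk (by omega)]
        · rw [if_pos rfl, h4, add_zero]
    · refine ⟨l, h1, fun x hx => ?_, fun k hk hkm => ?_⟩
      · have := h2 x hx
        omega
      · rcases Nat.lt_or_eq_of_le hkm with h | rfl
        · exact h3 k hk (by omega)
        · rw [h4]; omega

end ListCount

/-- The number of blocks of size `k` in the tuple given by the list `l` and the number `t`. -/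
def blockCount (l : List (ℕ × ℕ)) (t k : ℕ) : ℕ := listCount l k + if k = 1 then t else 0

/-- The sizes of the blocks of the tuple given by the list `l` and the number `t`. -/
def blockSizes (l : List (ℕ × ℕ)) (t : ℕ) :
    ((i : Fin l.length) × Fin (l.get i).2) ⊕ Fin t → ℕ :=
  Sum.elim (fun x => (l.get x.1).1) fun _ => 1

theorem sizeCount_blockSizes (l : List (ℕ × ℕ)) (t k : ℕ) :
    sizeCount (blockSizes l t) k = blockCount l t k := by
  rw [sizeCount_eq_sum, Fintype.sum_sum_type, Fintype.sum_sigma, blockCount]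
  congr 1
  · rw [listCount, ← Fin.sum_univ_fun_getElem]
    refine Finset.sum_congr rfl fun i _ => ?_
    change (∑ _y : Fin (l.get i).2, if (l.get i).1 = k then 1 else 0) =
      if (l.get i).1 = k then (l.get i).2 else 0
    split_ifs <;> simp
  · simp [blockSizes, eq_comm]

theorem jordanMatrix_one (κ : Type) [DecidableEq κ] (b : ℝ) :
    jordanMatrix (fun _ : κ => 1) (fun _ => b) =
      (b • (1 : Matrix κ κ ℝ)).submatrix (Equiv.sigmaUnique κ fun _ => Fin 1)
        (Equiv.sigmaUnique κ fun _ => Fin 1) := by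
  ext ⟨x, i⟩ ⟨y, j⟩
  obtain rfl := Subsingleton.elim i 0
  obtain rfl := Subsingleton.elim j 0
  by_cases h : x = y
  · subst h
    simp [jordanMatrix_apply]
  · simp [jordanMatrix_apply, h]

theorem areConjugate_blocks (l : List (ℕ × ℕ)) (t : ℕ) (b : ℝ) :
    AreConjugate (Matrix.fromBlocks (jordanBlocks b l) 0 0 (b • (1 : Matrix (Fin t) (Fin t) ℝ)))
      (jordanMatrix (blockSizes l t) fun _ => b) := by
  have h1 : AreConjugate (b • (1 : Matrix (Fin t) (Fin t) ℝ))
      (jordanMatrix (fun _ : Fin t => 1) fun _ => b) := by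
    rw [jordanMatrix_one]
    exact (AreConjugate.submatrix_equiv _ _).symm
  refine ((AreConjugate.refl (jordanBlocks b l)).fromBlocks h1).trans ?_
  refine (AreConjugate.jordanMatrix_sum _ _ _ _).trans ?_
  exact AreConjugate.jordanMatrix_congr (Equiv.refl _) (fun x => rfl) (by rintro (x | x) <;> rfl)

/-! ### Jordan tuples characterized by block counts. -/

section ConjugateToJordan

variable {ι κ : Type} [Fintype ι] [DecidableEq ι] [Fintype κ] [DecidableEq κ]

theorem conjugateToJordan_blocks_iff {A : Matrix ι ι ℝ} {b : ℝ} {f : κ → ℕ}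
    (hf : AreConjugate A (jordanMatrix f fun _ => b)) (l : List (ℕ × ℕ)) (t : ℕ) :
    ConjugateToJordan A b (.blocks l t) ↔ ∀ k, sizeCount f (k + 1) = blockCount l t (k + 1) := by
  simp only [← sizeCount_blockSizes]
  rw [← areConjugate_jordanMatrix_iff f (blockSizes l t) b]
  exact ⟨fun h => hf.symm.trans (AreConjugate.trans h (areConjugate_blocks l t b)),
    fun h => hf.trans (h.trans (areConjugate_blocks l t b).symm)⟩

/-- Lets the tuple `(m)` be treated as an empty list with `t = m`, although that pair is not an
admissible tuple. -/
theorem conjugateToJordan_scalar_iff {A : Matrix ι ι ℝ} {b : ℝ} (m : ℕ) :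
    ConjugateToJordan A b (.scalar m) ↔ ConjugateToJordan A b (.blocks [] m) := by
  have h : AreConjugate (b • (1 : Matrix (Fin m) (Fin m) ℝ))
      (Matrix.fromBlocks (jordanBlocks b []) 0 0 (b • (1 : Matrix (Fin m) (Fin m) ℝ))) := by
    have : IsEmpty ((x : (i : Fin [].length) × Fin (([] : List (ℕ × ℕ)).get i).2) ×
        Fin (([] : List (ℕ × ℕ)).get x.1).1) := ⟨fun x => x.1.1.elim0⟩
    convert (AreConjugate.submatrix_equiv (b • (1 : Matrix (Fin m) (Fin m) ℝ))
      (Equiv.emptySum ((x : (i : Fin [].length) × Fin (([] : List (ℕ × ℕ)).get i).2) ×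
        Fin (([] : List (ℕ × ℕ)).get x.1).1) (Fin m))).symm using 1
    ext (i | i) (j | j)
    · exact isEmptyElim i
    · exact isEmptyElim i
    · exact isEmptyElim j
    · simp [Matrix.one_apply]
  exact ⟨fun h' => AreConjugate.trans h' h, fun h' => AreConjugate.trans h' h.symm⟩

/-- Conjugate matrices have the same size, so the size condition on a tuple is automatic. -/
theorem ConjugateToJordan.sum_eq {m : ℕ} {A : Matrix (Fin m) (Fin m) ℝ} {b : ℝ}
    {l : List (ℕ × ℕ)} {t : ℕ} (h : ConjugateToJordan A b (.blocks l t)) :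
    (l.map fun x => x.1 * x.2).sum + t = m := by
  have h1 := AreConjugate.card_eq h
  rw [Fintype.card_fin, Fintype.card_sum, Fintype.card_fin, Fintype.card_sigma,
    Fintype.sum_sigma] at h1
  rw [h1, ← Fin.sum_univ_fun_getElem]
  congr 1
  refine Finset.sum_congr rfl fun i _ => ?_
  simp [mul_comm]

theorem hasJordanTuple_scalar_iff {m : ℕ} {A : Matrix (Fin m) (Fin m) ℝ} {b : ℝ} {f : κ → ℕ}
    (hf : AreConjugate A (jordanMatrix f fun _ => b)) :
    HasJordanTuple A b (.scalar m) ↔ ∀ k, sizeCount f (k + 1) = blockCount [] m (k + 1) := by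
  rw [HasJordanTuple, conjugateToJordan_scalar_iff, conjugateToJordan_blocks_iff hf]
  exact and_iff_right rfl

theorem hasJordanTuple_blocks_iff {m : ℕ} {A : Matrix (Fin m) (Fin m) ℝ} {b : ℝ} {f : κ → ℕ}
    (hf : AreConjugate A (jordanMatrix f fun _ => b)) (l : List (ℕ × ℕ)) (t : ℕ) :
    HasJordanTuple A b (.blocks l t) ↔ (l ≠ [] ∧ l.Pairwise (fun x y => y.1 < x.1) ∧
      ∀ x ∈ l, 2 ≤ x.1 ∧ 0 < x.2) ∧ ∀ k, sizeCount f (k + 1) = blockCount l t (k + 1) := by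
  rw [HasJordanTuple, ← conjugateToJordan_blocks_iff hf]
  constructor
  · rintro ⟨⟨h1, h2, h3, -⟩, h⟩
    exact ⟨⟨h1, h2, h3⟩, h⟩
  · rintro ⟨⟨h1, h2, h3⟩, h⟩
    exact ⟨⟨h1, h2, h3, h.sum_eq⟩, h⟩

end ConjugateToJordan

/-! ### The nilpotent case -/

theorem admitsSymplectic_of_blocks {ι : Type} [Fintype ι] [DecidableEq ι] {M : Matrix ι ι ℝ}
    {l : List (ℕ × ℕ)} {t : ℕ} (h : ConjugateToJordan M 0 (.blocks l t))
    (hl : (Odd t ∧ ∀ i : Fin l.length, Odd (l.get i).1 → Even (l.get i).2) ∨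
      (Even t ∧ ∃! i : Fin l.length, Odd (l.get i).1 ∧ Odd (l.get i).2)) :
    AdmitsSymplectic (AlmostAbelian M) := by
  -- The `1 × 1` blocks become one more family, of size 1 and multiplicity `t`; the two alternatives
  -- of `hl` then merge into the existence of a unique family with odd size and odd multiplicity.
  let n : Fin l.length ⊕ Unit → ℕ := Sum.elim (fun i => (l.get i).1) fun _ => 1
  let p : Fin l.length ⊕ Unit → ℕ := Sum.elim (fun i => (l.get i).2) fun _ => t
  have hp : ∃! i, Odd (n i) ∧ Odd (p i) := by
    rcases hl with ⟨ht, hl⟩ | ⟨ht, i, hi, hu⟩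
    · refine ⟨Sum.inr (), ⟨odd_one, ht⟩, ?_⟩
      rintro (j | j) ⟨h1, h2⟩
      · exact absurd (hl j h1) (Nat.not_even_iff_odd.2 h2)
      · rfl
    · refine ⟨Sum.inl i, hi, ?_⟩
      rintro (j | j) h
      · exact congrArg _ (hu j h)
      · exact absurd ht (Nat.not_even_iff_odd.2 h.2)
  let E : ((i : Fin l.length ⊕ Unit) × Fin (p i)) ≃
      ((i : Fin l.length) × Fin (l.get i).2) ⊕ Fin t :=
    (Equiv.sumSigmaDistrib fun i => Fin (p i)).trans
      (Equiv.sumCongr (Equiv.refl _) (Equiv.uniqueSigma fun _ => Fin t))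
  have hconj : AreConjugate M
      (jordanMatrix (fun x : (i : Fin l.length ⊕ Unit) × Fin (p i) => n x.1) fun _ => 0) := by
    refine AreConjugate.trans h ((areConjugate_blocks l t 0).trans (AreConjugate.symm ?_))
    exact AreConjugate.jordanMatrix_congr E (by rintro ⟨i | i, j⟩ <;> rfl) fun _ => rfl
  rw [hconj.admitsSymplectic_iff]
  exact admitsSymplectic_jordanMatrix_zero n p hp

theorem admitsSymplectic_iff_of_single_zero {m : ℕ} (hm : Odd m) {M : Matrix (Fin m) (Fin m) ℝ}
    (hM : HasSingleEigenvalue M 0) :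
    AdmitsSymplectic (AlmostAbelian M) ↔ ∃ τ ∈ symplecticTuples m, HasJordanTuple M 0 τ := by
  constructor
  · intro h
    obtain ⟨η, α, h⟩ := (admitsSymplectic_iff M).1 h
    obtain ⟨d, f, hf⟩ := hM.exists_areConjugate
    obtain ⟨k₀, ⟨hk₀, hodd⟩, huniq⟩ := h.odd_card (by simpa using hm) hf
    obtain ⟨l, h1, h2, h3⟩ := exists_list_of_count (sizeCount f) (∑ x, f x)
    have hcount : ∀ k, sizeCount f (k + 1) = blockCount l (sizeCount f 1) (k + 1) := by
      intro k
      rw [blockCount]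
      rcases k with _ | k
      · rw [listCount_eq_zero fun x hx => by have := h2 x hx; omega]
        simp
      · rw [if_neg (by omega), add_zero]
        rcases le_or_gt (k + 1 + 1) (∑ x, f x) with hk | hk
        · exact (h3 _ (by omega) hk).symm
        · rw [listCount_eq_zero fun x hx => by have := h2 x hx; omega, sizeCount_eq_sum]
          refine Finset.sum_eq_zero fun x _ => if_neg ?_
          have := Finset.single_le_sum (f := f) (fun _ _ => Nat.zero_le _) (Finset.mem_univ x)
          omega
    by_cases hl : l = []
    · subst hl
      have hc := (conjugateToJordan_blocks_iff hf _ _).2 hcount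
      have hs : sizeCount f 1 = m := by simpa using hc.sum_eq
      rw [hs] at hc
      exact ⟨.scalar m, ⟨rfl, trivial⟩, rfl, conjugateToJordan_scalar_iff m |>.2 hc⟩
    · have hJ := (hasJordanTuple_blocks_iff hf l (sizeCount f 1)).2
        ⟨⟨hl, h1, fun x hx => ⟨(h2 x hx).1, (h2 x hx).2.1⟩⟩, hcount⟩
      refine ⟨_, ⟨hJ.1, ?_⟩, hJ⟩
      have hget : ∀ i : Fin l.length, sizeCount f (l.get i).1 = (l.get i).2 := by
        intro i
        have hi := h2 _ (l.get_mem i)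
        rw [← listCount_get h1 i, h3 _ hi.1 hi.2.2]
      -- The exceptional odd size is 1, so `t` is odd, or it is some `n_ℓ` of the list.
      rcases eq_or_ne k₀ 1 with rfl | hne
      · refine Or.inl ⟨hodd, fun i hi => ?_⟩
        by_contra hp
        rw [Nat.not_even_iff_odd, ← hget] at hp
        have := huniq _ ⟨hi, hp⟩
        have := h2 _ (l.get_mem i)
        omega
      · right
        have ht : Even (sizeCount f 1) := by
          by_contra ht
          exact hne (huniq 1 ⟨odd_one, Nat.not_even_iff_odd.1 ht⟩).symm
        refine ⟨ht, ?_⟩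
        have hpos : listCount l k₀ ≠ 0 := by
          have := hcount (k₀ - 1)
          rw [blockCount, Nat.sub_add_cancel hk₀.pos, if_neg hne, add_zero] at this
          rw [← this]
          exact hodd.pos.ne'
        obtain ⟨i, rfl⟩ := exists_get_of_listCount_ne_zero hpos
        refine ⟨i, ⟨hk₀, hget i ▸ hodd⟩, fun j hj => ?_⟩
        exact get_fst_injective h1 (huniq _ ⟨hj.1, (congrArg Odd (hget j)).mpr hj.2⟩)
  · rintro ⟨τ, ⟨-, hτ⟩, hτm, hconj⟩
    cases τ with
    | scalar m' =>
      obtain rfl : m' = m := hτm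
      exact admitsSymplectic_of_blocks ((conjugateToJordan_scalar_iff m').1 hconj)
        (Or.inl ⟨hm, fun i => i.elim0⟩)
    | blocks l t => exact admitsSymplectic_of_blocks hconj hτ

/-! ### The case of two opposite eigenvalues -/

section Opposite

variable {ι ι' μ κ κ' : Type} [Fintype ι] [DecidableEq ι] [Fintype ι'] [DecidableEq ι']
  [Fintype μ] [DecidableEq μ] [Fintype κ] [DecidableEq κ] [Fintype κ'] [DecidableEq κ']

/-- Adjoining an empty block gives every admissible `h`, including `h = 0`, a block to enlarge. -/
theorem exists_areConjugate_size_eq (g : κ → ℕ) (b : ℝ) (h : ℕ)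
    (hpos : h ≠ 0 → sizeCount g h ≠ 0) :
    ∃ g' : Option κ → ℕ, AreConjugate (jordanMatrix g fun _ => b) (jordanMatrix g' fun _ => b) ∧
      ∃ x₀, g' x₀ = h := by
  refine ⟨fun o => o.elim 0 g, (areConjugate_jordanMatrix_iff _ _ b).2 fun k => ?_, ?_⟩
  · rw [sizeCount_eq_sum, sizeCount_eq_sum, Fintype.sum_option]
    rw [Option.elim_none, if_neg (Nat.succ_ne_zero k).symm, zero_add]
    rfl
  · rcases eq_or_ne h 0 with rfl | hh
    · exact ⟨none, rfl⟩
    · have := hpos hh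
      rw [sizeCount, Ne, Fintype.card_eq_zero_iff, not_isEmpty_iff] at this
      obtain ⟨x, hx⟩ := this
      exact ⟨some x, hx⟩

theorem sizeCount_add_single (g : κ → ℕ) (x₀ : κ) (k : ℕ) :
    sizeCount (fun x => g x + if x = x₀ then 1 else 0) k + (if k = g x₀ then 1 else 0) =
      sizeCount g k + if k = g x₀ + 1 then 1 else 0 := by
  have h1 : ∀ r, (if k = g x₀ + r then 1 else 0) =
      ∑ x, if x = x₀ then (if k = g x + r then 1 else 0) else 0 := by
    intro r
    simp
  have h2 := h1 0
  rw [add_zero] at h2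
  rw [h2, h1, sizeCount_eq_sum, sizeCount_eq_sum, ← Finset.sum_add_distrib,
    ← Finset.sum_add_distrib]
  refine Finset.sum_congr rfl fun x _ => ?_
  split_ifs <;> omega

/-- Here `h` is the size of the block at `-c` that is enlarged at `c`. Both corrections are added,
one on each side, to avoid subtraction in `ℕ`. -/
theorem admitsSymplectic_iff_of_opposite (hcard : Fintype.card ι = Fintype.card ι' + 1)
    {M : Matrix μ μ ℝ} {A : Matrix ι ι ℝ} {B : Matrix ι' ι' ℝ} {c : ℝ} (hc : c ≠ 0)
    (hM : AreConjugate M (Matrix.fromBlocks A 0 0 B)) {f : κ → ℕ} {g : κ' → ℕ}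
    (hA : AreConjugate A (jordanMatrix f fun _ => c))
    (hB : AreConjugate B (jordanMatrix g fun _ => -c)) :
    AdmitsSymplectic (AlmostAbelian M) ↔
      ∃ h : ℕ, ∀ k, sizeCount f (k + 1) + (if k + 1 = h then 1 else 0) =
        sizeCount g (k + 1) + if k = h then 1 else 0 := by
  rw [hM.admitsSymplectic_iff]
  constructor
  · intro h
    obtain ⟨η, α, h⟩ := (admitsSymplectic_iff _).1 h
    have hA' := hA.sub_smul_one c
    have hB' := hB.sub_smul_one (-c)
    rw [jordanMatrix_sub_smul_one] at hA' hB'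
    have hnil : ∀ {ι κ : Type} [Fintype ι] [DecidableEq ι] [Fintype κ] [DecidableEq κ]
        {N : Matrix ι ι ℝ} {f : κ → ℕ}, AreConjugate N (jordanMatrix f fun _ => 0) →
        IsNilpotent N := fun {ι κ} _ _ _ _ {N f} hN =>
      ⟨∑ x, f x, (hN.pow _).eq_zero (jordanMatrix_pow_eq_zero f _ fun x =>
        Finset.single_le_sum (f := f) (fun _ _ => Nat.zero_le _) (Finset.mem_univ x))⟩
    rw [← sub_add_cancel A (c • 1), ← sub_add_cancel B (-c • 1)] at h
    obtain ⟨h0, hh0⟩ := h.exists_rank_eq hcard hc (hnil hA') (hnil hB')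
    have hr : ∀ k, ∑ x, (f x - k) = ∑ x, (g x - k) + if k ≤ h0 then 1 else 0 := fun k => by
      rw [← rank_jordanMatrix_pow, ← rank_jordanMatrix_pow, ← (hA'.pow k).rank_eq,
        ← (hB'.pow k).rank_eq, hh0]
    refine ⟨h0, fun k => ?_⟩
    -- The second difference of `[k ≤ h0]` is `[k = h0] - [k + 1 = h0]`.
    have h1 := sum_tsub_add_sum_tsub f k
    have h2 := sum_tsub_add_sum_tsub g k
    rw [hr, hr, hr] at h1
    simp only [sizeCount]
    split_ifs at h1 ⊢ <;> omega
  · rintro ⟨h0, hh0⟩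
    obtain ⟨g', hg', x₀, rfl⟩ := exists_areConjugate_size_eq g (-c) h0 fun hne => by
      have := hh0 (h0 - 1)
      rw [if_pos (by omega), if_neg (by omega), Nat.sub_add_cancel (by omega)] at this
      omega
    have hgg := (areConjugate_jordanMatrix_iff _ _ _).1 hg'
    have hff : AreConjugate (jordanMatrix f fun _ => c)
        (jordanMatrix (fun x => g' x + if x = x₀ then 1 else 0) fun _ => c) := by
      refine (areConjugate_jordanMatrix_iff _ _ _).2 fun k => ?_
      have h1 := hh0 k
      have h2 := sizeCount_add_single g' x₀ (k + 1)
      rw [hgg] at h1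
      simp only [add_left_inj] at h2
      omega
    rw [((hA.trans hff).fromBlocks (hB.trans hg')).admitsSymplectic_iff,
      (AreConjugate.jordanMatrix_sum _ _ _ _).admitsSymplectic_iff]
    exact admitsSymplectic_jordanMatrix_sum _ g' c x₀ fun _ => rfl

/-- For a diagonal matrix `D`, `D (D u) = 0` implies `D u = 0`; conjugation carries this to `A - c`.
-/
theorem Diagonalizable.eq_smul_one {M : Matrix μ μ ℝ} (hD : Diagonalizable M) {A : Matrix ι ι ℝ}
    {B : Matrix ι' ι' ℝ} {c : ℝ} (hM : AreConjugate M (Matrix.fromBlocks A 0 0 B))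
    (hA : (A - c • 1) ^ 2 = 0) : A = c • 1 := by
  obtain ⟨v, hv⟩ := hD
  obtain ⟨P, Q, h1, h2, h3⟩ := (hM.symm.trans hv).sub_smul_one c
  have hdiag : Matrix.diagonal v - c • 1 = Matrix.diagonal fun i => v i - c := by
    ext i j
    by_cases h : i = j
    · subst h; simp
    · simp [h]
  rw [hdiag] at h3
  have hX : Matrix.fromBlocks A 0 0 B - c • 1 = Matrix.fromBlocks (A - c • 1) 0 0 (B - c • 1) := by
    rw [← Matrix.fromBlocks_one, Matrix.fromBlocks_smul, sub_eq_add_neg, Matrix.fromBlocks_neg,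
      Matrix.fromBlocks_add]
    simp [sub_eq_add_neg]
  rw [hX] at h3
  set D := Matrix.diagonal fun i => v i - c with hDdef
  set N := A - c • 1
  rw [← sub_eq_zero]
  change N = 0
  refine Matrix.ext_of_mulVec_single fun i => ?_
  set u : ι → ℝ := Pi.single i 1
  have h4 : P.mulVec (D.mulVec (Q.mulVec (Sum.elim u 0))) = Sum.elim (N.mulVec u) 0 := by
    rw [Matrix.mulVec_mulVec, Matrix.mulVec_mulVec, ← h3,
      Matrix.fromBlocks_mulVec]
    simp
  have h5 : P.mulVec (D.mulVec (Q.mulVec (Sum.elim (N.mulVec u) 0))) = 0 := by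
    rw [Matrix.mulVec_mulVec, Matrix.mulVec_mulVec, ← h3,
      Matrix.fromBlocks_mulVec]
    simp [← sq, hA]
  have hQ : ∀ w, Q.mulVec (P.mulVec w) = w := fun w => by
    rw [Matrix.mulVec_mulVec, h2, Matrix.one_mulVec]
  rw [← h4, hQ] at h5
  have h6 : D.mulVec (D.mulVec (Q.mulVec (Sum.elim u 0))) = 0 := by
    rw [← hQ (D.mulVec _), h5, Matrix.mulVec_zero]
  have h7 : D.mulVec (Q.mulVec (Sum.elim u 0)) = 0 := by
    funext j
    have := congrFun h6 j
    simp only [hDdef, Matrix.mulVec_diagonal, Pi.zero_apply, mul_eq_zero] at this ⊢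
    tauto
  rw [h7, Matrix.mulVec_zero] at h4
  rw [Matrix.zero_mulVec]
  funext j
  exact (congrFun h4 (Sum.inl j)).symm

theorem diagonalizable_of_smul_one {M : Matrix μ μ ℝ} {a b : ℝ}
    (hM : AreConjugate M
      (Matrix.fromBlocks (a • (1 : Matrix ι ι ℝ)) 0 0 (b • (1 : Matrix ι' ι' ℝ)))) :
    Diagonalizable M := by
  have e : μ ≃ ι ⊕ ι' := Fintype.equivOfCardEq hM.card_eq
  let v : ι ⊕ ι' → ℝ := Sum.elim (fun _ => a) fun _ => b
  refine ⟨v ∘ e, ?_⟩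
  have h1 : Matrix.fromBlocks (a • (1 : Matrix ι ι ℝ)) 0 0 (b • (1 : Matrix ι' ι' ℝ)) =
      Matrix.diagonal v := by
    rw [Matrix.smul_one_eq_diagonal, Matrix.smul_one_eq_diagonal, Matrix.fromBlocks_diagonal]
  have h2 : Matrix.diagonal (v ∘ e) = (Matrix.diagonal v).submatrix e e :=
    (Matrix.submatrix_diagonal_equiv v e).symm
  rw [h1] at hM
  rw [h2]
  exact hM.trans (AreConjugate.submatrix_equiv _ e).symm

end Opposite

/-! ### Enlarging one block of a tuple -/

section Enlargement

/-- The list of a tuple with at least one block of size at least two. -/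
def IsBlockList (l : List (ℕ × ℕ)) : Prop :=
  l ≠ [] ∧ l.Pairwise (fun x y => y.1 < x.1) ∧ ∀ x ∈ l, 2 ≤ x.1 ∧ 0 < x.2

theorem IsBlockList.dropZero {l : List (ℕ × ℕ)} (h1 : ∃ x ∈ l, 0 < x.2)
    (h2 : l.Pairwise fun x y => y.1 < x.1) (h3 : ∀ x ∈ l, 2 ≤ x.1) :
    IsBlockList (dropZero l) := by
  refine ⟨?_, h2.filter _, fun x hx => ?_⟩
  · obtain ⟨x, hx, hpos⟩ := h1
    refine List.ne_nil_of_mem (a := x) (List.mem_filter.2 ⟨hx, ?_⟩)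
    simpa using hpos.ne'
  · obtain ⟨hx, hx'⟩ := List.mem_filter.1 hx
    have : x.2 ≠ 0 := by simpa using hx'
    exact ⟨h3 x hx, Nat.pos_of_ne_zero this⟩

/-- An enlargement has an admissible list, one block of size `n_d` less and one of size `n_d + 1`
more. -/
theorem IsEnlargementAt.exists_blocks {l : List (ℕ × ℕ)} (hl : IsBlockList l) {t : ℕ}
    {d : Fin l.length} {τ : JordanTuple} (h : IsEnlargementAt l t d τ) :
    ∃ l', τ = .blocks l' t ∧ IsBlockList l' ∧
      ∀ k, blockCount l' t k + (if k = (l.get d).1 then 1 else 0) =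
        blockCount l t k + if k = (l.get d).1 + 1 then 1 else 0 := by
  obtain ⟨-, hpw, hmem⟩ := hl
  have hd : l = l.take d ++ l.get d :: l.drop (d + 1) := by simp
  have hdpos := hmem _ (l.get_mem d)
  rcases h with ⟨e, hed, hsize, rfl⟩ | ⟨hgap, rfl⟩
  · have he : l = l.take e ++ l.get e :: l.get d :: l.drop (d + 1) := by
      have : l.drop (e + 1) = l.get d :: l.drop (d + 1) := by
        rw [hed]; exact List.drop_eq_getElem_cons d.2
      rw [← this]; simp
    generalize l.take e = l₁ at *
    generalize l.drop (d + 1) = l₂ at *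
    generalize l.get e = x at *
    generalize l.get d = y at *
    obtain ⟨a, p⟩ := y
    obtain ⟨b, q⟩ := x
    dsimp at *
    subst hsize
    rw [he] at hpw hmem
    refine ⟨_, rfl, IsBlockList.dropZero ⟨(a + 1, q + 1), by simp, by simp⟩ ?_ ?_, fun k => ?_⟩
    · simpa [List.pairwise_append] using hpw
    · simp only [List.mem_append, List.mem_cons] at hmem ⊢
      rintro z (hz | rfl | rfl | hz)
      · exact (hmem z (by simp [hz])).1
      · dsimp; omega
      · exact hdpos.1
      · exact (hmem z (by simp [hz])).1
    · rw [blockCount, blockCount, listCount_dropZero, he]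
      simp only [listCount_append, listCount_cons]
      have := hdpos.2
      split_ifs <;> omega
  -- The gap above `n_d` passes to all earlier entries because the list is decreasing.
  · have hfst : ∀ x ∈ l.take d, (l.get d).1 + 1 < x.1 := by
      intro x hx
      obtain ⟨i, hi, rfl⟩ := List.mem_take_iff_getElem.1 hx
      have hid : i < d.val := by omega
      have h1 := hgap ⟨d - 1, by omega⟩ (by dsimp; omega)
      rcases Nat.lt_or_ge i (d - 1) with hlt | hge
      · exact h1.trans (List.pairwise_iff_getElem.1 hpw i (d - 1) (by omega) (by omega) hlt)
      · obtain rfl : i = d - 1 := by omega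
        exact h1
    generalize l.take d = l₁ at *
    generalize l.drop (d + 1) = l₂ at *
    generalize l.get d = y at *
    obtain ⟨a, p⟩ := y
    dsimp at *
    rw [hd] at hpw hmem
    refine ⟨_, rfl, IsBlockList.dropZero ⟨(a + 1, 1), by simp, by simp⟩ ?_ ?_, fun k => ?_⟩
    · rw [List.pairwise_append, List.pairwise_cons] at hpw ⊢
      obtain ⟨h1, ⟨h2, h3⟩, h4⟩ := hpw
      refine ⟨h1, ⟨?_, List.pairwise_cons.2 ⟨h2, h3⟩⟩, ?_⟩
      · intro z hz
        rcases List.mem_cons.1 hz with rfl | hz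
        · exact Nat.lt_succ_self a
        · exact (h2 z hz).trans (Nat.lt_succ_self a)
      · intro x hx z hz
        rcases List.mem_cons.1 hz with rfl | hz
        · exact hfst x hx
        · rcases List.mem_cons.1 hz with rfl | hz
          · exact (Nat.lt_succ_self a).trans (hfst x hx)
          · exact h4 x hx z (by simp [hz])
    · simp only [List.mem_append, List.mem_cons] at hmem ⊢
      rintro z (hz | rfl | rfl | hz)
      · exact (hmem z (by simp [hz])).1
      · dsimp; omega
      · exact hdpos.1
      · exact (hmem z (by simp [hz])).1
    · rw [blockCount, blockCount, listCount_dropZero, hd]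
      simp only [listCount_append, listCount_cons]
      have := hdpos.2
      split_ifs <;> omega

theorem exists_isEnlargementAt {l : List (ℕ × ℕ)} (hl : l.Pairwise fun x y => y.1 < x.1) (t : ℕ)
    (d : Fin l.length) : ∃ τ, IsEnlargementAt l t d τ := by
  by_cases h : ∃ e : Fin l.length, e.val + 1 = d.val ∧ (l.get e).1 = (l.get d).1 + 1
  · obtain ⟨e, h1, h2⟩ := h
    exact ⟨_, Or.inl ⟨e, h1, h2, rfl⟩⟩
  · refine ⟨_, Or.inr ⟨fun e he => ?_, rfl⟩⟩
    have h1 := List.pairwise_iff_get.1 hl e d (by rw [Fin.lt_def]; omega)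
    have h2 : (l.get e).1 ≠ (l.get d).1 + 1 := fun h' => h ⟨e, he, h'⟩
    omega

theorem IsOneToTwo.exists_blocks {l : List (ℕ × ℕ)} (hl : IsBlockList l) {t : ℕ}
    {τ : JordanTuple} (h : IsOneToTwo l t τ) :
    ∃ l', τ = .blocks l' (t - 1) ∧ IsBlockList l' ∧
      ∀ k, blockCount l' (t - 1) k + (if k = 1 then 1 else 0) =
        blockCount l t k + if k = 2 then 1 else 0 := by
  obtain ⟨ht, l', a, p, rfl, h⟩ := h
  obtain ⟨-, hpw, hmem⟩ := hl
  rcases h with ⟨ha, rfl⟩ | ⟨rfl, rfl⟩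
  · refine ⟨_, rfl, ⟨by simp, ?_, ?_⟩, fun k => ?_⟩
    · rw [List.pairwise_append]
      refine ⟨hpw, by simp, fun x hx y hy => ?_⟩
      rw [List.mem_singleton] at hy
      subst hy
      rw [List.pairwise_append] at hpw
      rcases List.mem_append.1 hx with hx | hx
      · exact ha.trans (hpw.2.2 x hx (a, p) (by simp))
      · rw [List.mem_singleton] at hx
        subst hx
        exact ha
    · intro x hx
      rcases List.mem_append.1 hx with hx | hx
      · exact hmem x hx
      · rw [List.mem_singleton] at hx
        subst hx
        simp
    · simp only [blockCount, listCount_append, listCount_cons, listCount_nil]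
      split_ifs <;> omega
  · refine ⟨_, rfl, ⟨by simp, ?_, ?_⟩, fun k => ?_⟩
    · simpa [List.pairwise_append] using hpw
    · intro x hx
      rcases List.mem_append.1 hx with hx | hx
      · exact hmem x (by simp [hx])
      · rw [List.mem_singleton] at hx
        subst hx
        simp
    · simp only [blockCount, listCount_append, listCount_cons, listCount_nil]
      split_ifs <;> omega

theorem exists_isOneToTwo {l : List (ℕ × ℕ)} (hl : IsBlockList l) {t : ℕ} (ht : 1 ≤ t) :
    ∃ τ, IsOneToTwo l t τ := by
  obtain ⟨hne, -, hmem⟩ := hl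
  obtain ⟨l', ⟨a, p⟩, rfl⟩ := List.eq_nil_or_concat' l |>.resolve_left hne
  have ha := (hmem (a, p) (by simp)).1
  rcases Nat.lt_or_eq_of_le ha with ha | rfl
  · exact ⟨_, ht, l', a, p, rfl, Or.inl ⟨ha, rfl⟩⟩
  · exact ⟨_, ht, l', 2, p, rfl, Or.inr ⟨rfl, rfl⟩⟩

end Enlargement

/-! ### From the shift of block counts to the listed tuples. -/

section OppositeTuples

variable {n : ℕ} {κ κ' : Type} [Fintype κ] [DecidableEq κ] [Fintype κ']
  {A : Matrix (Fin n) (Fin n) ℝ} {c : ℝ} {f : κ → ℕ} {g : κ' → ℕ}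

/-- A shift of one box between two block counts, when the smaller one is `(n₁, …; p₁, …; t)`. -/
theorem exists_shift_iff_of_blocks (hA : AreConjugate A (jordanMatrix f fun _ => c))
    {l : List (ℕ × ℕ)} (hl : IsBlockList l) {t : ℕ}
    (hg : ∀ k, sizeCount g (k + 1) = blockCount l t (k + 1)) :
    (∃ h : ℕ, ∀ k, sizeCount f (k + 1) + (if k + 1 = h then 1 else 0) =
        sizeCount g (k + 1) + if k = h then 1 else 0) ↔
      HasJordanTuple A c (.blocks l (t + 1)) ∨
        (∃! d : Fin l.length, ∃ τ, IsEnlargementAt l t d τ ∧ HasJordanTuple A c τ) ∨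
        (∃ τ, IsOneToTwo l t τ ∧ HasJordanTuple A c τ) := by
  simp only [hg]
  have hone : listCount l 1 = 0 := listCount_eq_zero fun x hx => by
    have := hl.2.2 x hx; omega
  constructor
  · rintro ⟨h, hh⟩
    -- Size 0 adds a `1 × 1` block, size 1 turns a `1 × 1` block into size 2, and a larger size must
    -- be some `n_d`.
    rcases h with _ | _ | h
    · refine Or.inl ((hasJordanTuple_blocks_iff hA _ _).2 ⟨hl, fun k => ?_⟩)
      have := hh k
      simp only [blockCount] at this ⊢
      split_ifs at this ⊢ <;> first | contradiction | omega
    · refine Or.inr (Or.inr ?_)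
      have ht : 1 ≤ t := by
        have := hh 0
        simp [blockCount, hone] at this
        omega
      obtain ⟨τ, hτ⟩ := exists_isOneToTwo hl ht
      refine ⟨τ, hτ, ?_⟩
      obtain ⟨l', rfl, hl', hcount⟩ := hτ.exists_blocks hl
      refine (hasJordanTuple_blocks_iff hA _ _).2 ⟨hl', fun k => ?_⟩
      have h1 := hh k
      have h2 := hcount (k + 1)
      split_ifs at h1 h2 <;> first | contradiction | omega
    · refine Or.inr (Or.inl ?_)
      have hpos : listCount l (h + 1 + 1) ≠ 0 := by
        have := hh (h + 1)
        simp only [blockCount] at this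
        split_ifs at this <;> first | contradiction | omega
      obtain ⟨d, hd⟩ := exists_get_of_listCount_ne_zero hpos
      refine ⟨d, ?_, ?_⟩
      · obtain ⟨τ, hτ⟩ := exists_isEnlargementAt hl.2.1 t d
        refine ⟨τ, hτ, ?_⟩
        obtain ⟨l', rfl, hl', hcount⟩ := hτ.exists_blocks hl
        refine (hasJordanTuple_blocks_iff hA _ _).2 ⟨hl', fun k => ?_⟩
        have h1 := hh k
        have h2 := hcount (k + 1)
        rw [hd] at h2
        split_ifs at h1 h2 <;> first | contradiction | omega
      -- The enlarged size is the only one whose count drops, so it determines the index.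
      · rintro d' ⟨τ, hτ, hJ⟩
        obtain ⟨l', rfl, hl', hcount⟩ := hτ.exists_blocks hl
        have hJ' := ((hasJordanTuple_blocks_iff hA _ _).1 hJ).2 (h + 1)
        have h1 := hh (h + 1)
        have h2 := hcount (h + 1 + 1)
        refine get_fst_injective hl.2.1 (hd.symm ▸ ?_ : (l.get d').1 = (l.get d).1)
        split_ifs at h1 h2 <;> first | contradiction | omega
  · rintro (hJ | ⟨d, ⟨τ, hτ, hJ⟩, -⟩ | ⟨τ, hτ, hJ⟩)
    · refine ⟨0, fun k => ?_⟩
      rw [((hasJordanTuple_blocks_iff hA _ _).1 hJ).2]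
      simp only [blockCount]
      split_ifs <;> first | contradiction | omega
    · obtain ⟨l', rfl, hl', hcount⟩ := hτ.exists_blocks hl
      refine ⟨(l.get d).1, fun k => ?_⟩
      rw [((hasJordanTuple_blocks_iff hA _ _).1 hJ).2]
      have := hcount (k + 1)
      simpa using this
    · obtain ⟨l', rfl, hl', hcount⟩ := hτ.exists_blocks hl
      refine ⟨1, fun k => ?_⟩
      rw [((hasJordanTuple_blocks_iff hA _ _).1 hJ).2]
      have := hcount (k + 1)
      simpa using this

/-- A shift of one box between two block counts, when the smaller one is the scalar tuple. -/
theorem exists_shift_iff_of_scalar (hn : 2 ≤ n) (hA : AreConjugate A (jordanMatrix f fun _ => c))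
    (hg : ∀ k, sizeCount g (k + 1) = blockCount [] (n - 1) (k + 1)) :
    (∃ h : ℕ, ∀ k, sizeCount f (k + 1) + (if k + 1 = h then 1 else 0) =
        sizeCount g (k + 1) + if k = h then 1 else 0) ↔
      HasJordanTuple A c (.scalar n) ∨ HasJordanTuple A c (.blocks [(2, 1)] (n - 2)) := by
  rw [hasJordanTuple_scalar_iff hA, hasJordanTuple_blocks_iff hA]
  simp only [hg, blockCount, listCount_nil, listCount_cons, zero_add]
  constructor
  · rintro ⟨h, hh⟩
    rcases h with _ | _ | h
    · refine Or.inl fun k => ?_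
      have := hh k
      split_ifs at this ⊢ <;> first | contradiction | omega
    · refine Or.inr ⟨by simp, fun k => ?_⟩
      have := hh k
      split_ifs at this ⊢ <;> first | contradiction | omega
    -- No block of size at least 2 is available to enlarge.
    · have := hh (h + 1)
      split_ifs at this <;> first | contradiction | omega
  · rintro (h | ⟨-, h⟩)
    · refine ⟨0, fun k => ?_⟩
      rw [h]
      split_ifs <;> first | contradiction | omega
    · refine ⟨1, fun k => ?_⟩
      rw [h]
      split_ifs <;> first | contradiction | omega

end OppositeTuples

/-! ### Diagonalizability and the final assembly. -/

theorem HasJordanTuple.eq_smul_one {m : ℕ} {A : Matrix (Fin m) (Fin m) ℝ} {b : ℝ}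
    (h : HasJordanTuple A b (.scalar m)) : A = b • 1 :=
  AreConjugate.eq_smul_one (κ := Fin m) h.2

theorem HasJordanTuple.not_diagonalizable {μ ι' : Type} [Fintype μ] [DecidableEq μ] [Fintype ι']
    [DecidableEq ι'] {m s : ℕ} {M : Matrix μ μ ℝ}
    {A : Matrix (Fin m) (Fin m) ℝ} {B : Matrix ι' ι' ℝ} {b : ℝ}
    (hM : AreConjugate M (Matrix.fromBlocks A 0 0 B))
    (hA : HasJordanTuple A b (.blocks [(2, 1)] s)) : ¬ Diagonalizable M := by
  intro hD
  have hconj := AreConjugate.trans hA.2 (areConjugate_blocks _ _ _)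
  have hsq : (A - b • 1) ^ 2 = 0 := by
    have := (hconj.sub_smul_one b).pow 2
    rw [jordanMatrix_sub_smul_one] at this
    refine this.eq_zero (jordanMatrix_pow_eq_zero _ _ ?_)
    rintro (⟨i, j⟩ | j)
    · obtain rfl : i = 0 := Subsingleton.elim (α := Fin 1) _ _
      exact le_rfl
    · exact one_le_two
  have hAb := hD.eq_smul_one hM hsq
  have h1 : HasJordanTuple A b (.scalar m) := ⟨rfl, by
    rw [hAb]; exact AreConjugate.refl _⟩
  -- The index 1 compares the numbers of blocks of size 2, namely 1 and 0.
  have h2 := (hasJordanTuple_scalar_iff hconj).1 h1 1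
  rw [sizeCount_blockSizes] at h2
  simp [blockCount] at h2

theorem theorem5p16 (n : ℕ) (hn : 2 ≤ n) (M : Matrix (Fin (2 * n - 1)) (Fin (2 * n - 1)) ℝ) :
    -- (I) the case `M = M(0)`
    (HasSingleEigenvalue M 0 →
      (AdmitsSymplectic (AlmostAbelian M) ↔
        ∃ τ ∈ symplecticTuples (2 * n - 1), HasJordanTuple M 0 τ)) ∧
    -- (II) the case `M = M(c) ⊕ M(-c)` with `c ≠ 0` and `m_c = n`; here `A = M(c)`, `B = M(-c)`
    (∀ (c : ℝ) (A : Matrix (Fin n) (Fin n) ℝ) (B : Matrix (Fin (n - 1)) (Fin (n - 1)) ℝ),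
      c ≠ 0 → HasSingleEigenvalue A c → HasSingleEigenvalue B (-c) →
      AreConjugate M (Matrix.fromBlocks A 0 0 B) →
      (HasJordanTuple B (-c) (.scalar (n - 1)) →
        (AdmitsSymplectic (AlmostAbelian M) ↔
          (Diagonalizable M ∧ HasJordanTuple A c (.scalar n)) ∨
          (¬ Diagonalizable M ∧ HasJordanTuple A c (.blocks [(2, 1)] (n - 2))))) ∧
      (∀ (l : List (ℕ × ℕ)) (t : ℕ), HasJordanTuple B (-c) (.blocks l t) →
        (AdmitsSymplectic (AlmostAbelian M) ↔
          HasJordanTuple A c (.blocks l (t + 1)) ∨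
          (∃! d : Fin l.length, ∃ τ, IsEnlargementAt l t d τ ∧ HasJordanTuple A c τ) ∨
          (∃ τ, IsOneToTwo l t τ ∧ HasJordanTuple A c τ)))) := by
  refine ⟨admitsSymplectic_iff_of_single_zero ⟨n - 1, by omega⟩, ?_⟩
  intro c A B hc hA hB hM
  obtain ⟨d, f, hf⟩ := hA.exists_areConjugate
  obtain ⟨d', g, hg⟩ := hB.exists_areConjugate
  have hcard : Fintype.card (Fin n) = Fintype.card (Fin (n - 1)) + 1 := by
    rw [Fintype.card_fin, Fintype.card_fin]; omega
  have key := admitsSymplectic_iff_of_opposite hcard hc hM hf hg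
  refine ⟨fun hBJ => ?_, fun l t hBJ => ?_⟩
  · rw [key, exists_shift_iff_of_scalar hn hf ((hasJordanTuple_scalar_iff hg).1 hBJ)]
    refine or_congr ?_ ?_
    -- Each tuple already decides whether `M` is diagonalizable, so these conditions add nothing.
    · refine (and_iff_right_of_imp fun hAJ => ?_).symm
      rw [hAJ.eq_smul_one, hBJ.eq_smul_one] at hM
      exact diagonalizable_of_smul_one hM
    · exact (and_iff_right_of_imp fun hAJ => hAJ.not_diagonalizable hM).symm
  · have h := (hasJordanTuple_blocks_iff hg l t).1 hBJ
    rw [key]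
    exact exists_shift_iff_of_blocks hf h.1 h.2
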